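/- **Setting.** Let $(A,\Omega,u)$ be a finite-dimensional abstract state space: $A$ is a finite-dimensional real vector space, $\Omega\subset A$ is convex and compact, $A_+:=\mathbb R_{\ge 0}\cdot\Omega$ is a closed, generating, pointed convex cone, and $u\in A^*$ satisfies $u(w)>0$ for $w\in A_+\setminus\{0\}$ and, for $w\in A_+$, $u(w)=1\Leftrightarrow w\in\Omega$. Elements of $\Omega$ are the states; its extreme points are the pure states. Effects are the $e\in A^*$ with $0\le e\le u$ on $A_+$. Let a set of allowed effects be given that is convex, contains $u$, contains $u-e$ for every allowed $e$, and contains $e+f$ for all allowed $e,f$ with $e+f\le u$ on $\Omega$. Let $\mathcal G$ be a group of invertible linear maps $T$ of $A$ (the allowed reversible transformations) with $T(A_+)\subset A_+$, $u\circ T\le u$ on $A_+$, and $e\circ T$ allowed for every allowed $e$. States $w_1,\dots,w_n$ are *perfectly distinguishable* if there are allowed effects $e_1,\dots,e_n$ with $\sum_j e_j\le u$ on $\Omega$ and $e_j(w_k)=\delta_{jk}$; if moreover all $w_j$ are pure, they form an *$n$-frame*. A *classical decomposition* of a state $w$ is $w=\sum_{j=1}^n p_jw_j$ with $(p_j)$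 a probability distribution and $w_1,\dots,w_n$ a frame. A *measurement* is a tuple $(e_1,\dots,e_N)$ of allowed effects with $\sum_je_j=u$. It is *fine-grained* if for every measurement $(f_1,\dots,f_m)$ and every map $M:\{1,\dots,m\}\to\{1,\dots,N\}$ with $\sum_{i:M(i)=k}f_i=e_k$ for all $k$, each $f_i$ is a multiple of $e_{M(i)}$. For a probability vector $\mathbf p$ let $H_\alpha(\mathbf p)=\frac1{1-\alpha}\log_2\sum_jp_j^\alpha$ for $\alpha\in(0,\infty)\setminus\{1\}$, $H_0(\mathbf p)=\log_2|\{j:p_j>0\}|$, $H_1(\mathbf p)=-\sum_jp_j\log_2p_j$ (with $0\log_2 0=0$), $H_\infty(\mathbf p)=-\log_2\max_jp_j$. The *order-$\alpha$ Rényi measurement entropy* of a state $w$ is $\widehat H_\alpha(w)=\inf H_\alpha(e_1(w),\dots,e_N(w))$ over all fine-grained measurements $(e_1,\dots,e_N)$, $N$ arbitrary; the *measurement entropy* is $\widehat H(w)=\inf\big[-\sum_j e_j(w)\log_2 e_j(w)\big]$ over the same measurements. **Theorem.** Assume (Postulate 1) that every state has a classical decomposition, and (Postulate 2) that for every $n$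 and all $n$-frames $(w_j)$, $(v_j)$ there is $T\in\mathcal G$ with $Tw_j=v_j$ for all $j$. Then: 1. Call an inner product $\langle\cdot,\cdot\rangle$ on $A$ *self-dualizing* if $\{f\in A^*: f\ge0\text{ on }A_+\}=\{\langle x,\cdot\rangle:x\in A_+\}$, it is $\mathcal G$-invariant, $0\le\langle w,v\rangle\le1$ for all states, $\langle w,w\rangle=1$ for pure and $<1$ for non-pure states $w$, and $\langle w,v\rangle=0$ for perfectly distinguishable states $w,v$. A self-dualizing inner product exists, and for every such inner product every effect $e_j$ of a fine-grained measurement has the form $e_j=c_j\langle w_j,\cdot\rangle$ with $c_j\in[0,1]$ and $w_j$ a pure state. 2. There is a maximal frame size $d$. For every $d$-frame $w_1,\dots,w_d$ there is a fine-grained measurement $(e_1,\dots,e_d)$ with $e_k(w_j)=\delta_{jk}$. Every fine-grained measurement $(e_1,\dots,e_N)$ has $N\ge d$. 3. If $w=\sum_{j=1}^np_jw_j$ is a classical decomposition of a state and $(e_1,\dots,e_N)$ is a fine-grained measurement, then there is a bistochastic $N\times N$ matrix $M$ with $(e_1(w),\dots,e_N(w))^{T}=M\,(p_1,\dots,p_n,0,\dots,0)^{T}$.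 4. For every state $w$, every classical decomposition $w=\sum_jp_jw_j$ and every $\alpha\in[0,\infty]$, $\widehat H_\alpha(w)=H_\alpha(\mathbf p)$. In particular the measurement entropy equals the thermodynamic (spectral) entropy: $\widehat H(w)=-\sum_jp_j\log_2p_j$. -/

import Mathlib

open scoped ENNReal

/-- A cone in the sense of convex geometry: non-empty, closed under addition and under
multiplication by non-negative scalars, and pointed. -/
structure IsPointedCone {A : Type*} [AddCommGroup A] [Module ℝ A] (K : Set A) : Prop where
  nonempty : K.Nonempty
  add_mem : ∀ x ∈ K, ∀ y ∈ K, x + y ∈ K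
  smul_mem : ∀ r : ℝ, 0 ≤ r → ∀ x ∈ K, r • x ∈ K
  pointed : ∀ x, x ∈ K → -x ∈ K → x = 0

/-- `ℝ≥0 · Ω`. -/
def coneOver {A : Type*} [AddCommGroup A] [Module ℝ A] (Ω : Set A) : Set A :=
  {x | ∃ r : ℝ, 0 ≤ r ∧ ∃ w ∈ Ω, x = r • w}

/-- An abstract state space `(A, Ω, u)`: normalized states `Ω` and order unit `u`. -/
structure AbstractStateSpace (A : Type*) [NormedAddCommGroup A] [NormedSpace ℝ A]
    [FiniteDimensional ℝ A] where
  /-- the set of normalized states -/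
  Ω : Set A
  /-- the order unit -/
  u : Module.Dual ℝ A
  convex : Convex ℝ Ω
  compact : IsCompact Ω
  cone : IsPointedCone (coneOver Ω)
  cone_closed : IsClosed (coneOver Ω)
  cone_generating : Submodule.span ℝ (coneOver Ω) = ⊤
  unit_pos : ∀ w ∈ coneOver Ω, w ≠ 0 → 0 < u w
  unit_eq_one_iff : ∀ w ∈ coneOver Ω, (u w = 1 ↔ w ∈ Ω)

namespace AbstractStateSpace

variable {A : Type*} [NormedAddCommGroup A] [NormedSpace ℝ A] [FiniteDimensional ℝ A]

/-- The cone `A₊` of unnormalized states. -/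
def Aplus (S : AbstractStateSpace A) : Set A := coneOver S.Ω

/-- Pure states are the extreme points of the set of normalized states. -/
def IsPure (S : AbstractStateSpace A) (w : A) : Prop := w ∈ Set.extremePoints ℝ S.Ω

/-- Effects: linear functionals with `0 ≤ e ≤ u` on the cone of states. -/
def IsEffect (S : AbstractStateSpace A) (e : Module.Dual ℝ A) : Prop :=
  ∀ w ∈ S.Aplus, 0 ≤ e w ∧ e w ≤ S.u w

/-- Transformations of the state space: positive and not normalization-increasing. -/
def IsTransformation (S : AbstractStateSpace A) (T : A →ₗ[ℝ] A) : Prop :=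
  (∀ w ∈ S.Aplus, T w ∈ S.Aplus) ∧ ∀ w ∈ S.Aplus, S.u (T w) ≤ S.u w

end AbstractStateSpace

/-- A dynamical state space: an abstract state space with the set of physically allowed effects
and the group of physically allowed reversible transformations. -/
structure DynamicalStateSpace (A : Type*) [NormedAddCommGroup A] [NormedSpace ℝ A]
    [FiniteDimensional ℝ A] extends AbstractStateSpace A where
  /-- the physically allowed effects -/
  allowed : Set (Module.Dual ℝ A)
  /-- the physically allowed reversible transformations -/
  𝒢 : Subgroup (A ≃ₗ[ℝ] A)
  allowed_isEffect : ∀ e ∈ allowed, toAbstractStateSpace.IsEffect e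
  allowed_convex : Convex ℝ allowed
  allowed_unit : u ∈ allowed
  allowed_compl : ∀ e ∈ allowed, u - e ∈ allowed
  allowed_add : ∀ e ∈ allowed, ∀ f ∈ allowed, (∀ w ∈ Ω, e w + f w ≤ u w) → e + f ∈ allowed
  /-- as `𝒢` is a group, the inverse of each member is a transformation too -/
  isTransformation : ∀ T ∈ 𝒢, toAbstractStateSpace.IsTransformation (T : A →ₗ[ℝ] A)
  allowed_comp : ∀ T ∈ 𝒢, ∀ e ∈ allowed, e ∘ₗ (T : A →ₗ[ℝ] A) ∈ allowed

namespace DynamicalStateSpace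

variable {A : Type*} [NormedAddCommGroup A] [NormedSpace ℝ A] [FiniteDimensional ℝ A]

/-- States `w₁, …, wₙ` are perfectly distinguishable if there are allowed effects with
`∑ eⱼ ≤ u` and `eⱼ(wₖ) = δⱼₖ`. -/
def PerfectlyDistinguishable (S : DynamicalStateSpace A) {n : ℕ} (w : Fin n → A) : Prop :=
  (∀ j, w j ∈ S.Ω) ∧
    ∃ e : Fin n → Module.Dual ℝ A, (∀ j, e j ∈ S.allowed) ∧
      (∀ v ∈ S.Ω, ∑ j, e j v ≤ S.u v) ∧ ∀ j k, e j (w k) = if j = k then 1 else 0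

/-- An `n`-frame: `n` perfectly distinguishable pure states. -/
def IsFrame (S : DynamicalStateSpace A) {n : ℕ} (w : Fin n → A) : Prop :=
  S.PerfectlyDistinguishable w ∧ ∀ j, S.IsPure (w j)

/-- `d` is the maximal frame size. -/
def IsMaxFrameSize (S : DynamicalStateSpace A) (d : ℕ) : Prop :=
  IsGreatest {n : ℕ | ∃ w : Fin n → A, S.IsFrame w} d

/-- `w = ∑ pⱼ vⱼ` is a classical decomposition: `p` is a probability distribution and the `vⱼ` are
perfectly distinguishable pure states. -/
def IsClassicalDecomposition (S : DynamicalStateSpace A) (w : A) {n : ℕ} (p : Fin n → ℝ)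
    (v : Fin n → A) : Prop :=
  (∀ j, 0 ≤ p j) ∧ ∑ j, p j = 1 ∧ S.IsFrame v ∧ w = ∑ j, p j • v j

/-- Every state has a classical decomposition. -/
def ClassicalDecomposability (S : DynamicalStateSpace A) : Prop :=
  ∀ w ∈ S.Ω, ∃ (n : ℕ) (p : Fin n → ℝ) (v : Fin n → A), S.IsClassicalDecomposition w p v

/-- Any two frames of the same size are related by a reversible transformation. -/
def StrongSymmetry (S : DynamicalStateSpace A) : Prop :=
  ∀ (n : ℕ) (w v : Fin n → A), S.IsFrame w → S.IsFrame v → ∃ T ∈ S.𝒢, ∀ j, T (w j) = v j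

/-- A (normalized) measurement: finitely many allowed effects that sum to the order unit. -/
def IsMeasurement (S : DynamicalStateSpace A) {n : ℕ} (e : Fin n → Module.Dual ℝ A) : Prop :=
  (∀ j, e j ∈ S.allowed) ∧ ∑ j, e j = S.u

/-- `e` is fine-grained: it is a measurement and every refinement `f` of `e`, with the outcomes of
`f` collected along `M`, is trivial, i.e. each `fᵢ` is proportional to `e_{M(i)}`. -/
def IsFineGrained (S : DynamicalStateSpace A) {n : ℕ} (e : Fin n → Module.Dual ℝ A) : Prop :=
  S.IsMeasurement e ∧
    ∀ (m : ℕ) (f : Fin m → Module.Dual ℝ A) (M : Fin m → Fin n), S.IsMeasurement f →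
      (∀ k, ∑ i with M i = k, f i = e k) → ∀ i, ∃ c : ℝ, f i = c • e (M i)

/-- A self-dualizing inner product adapted to the theory: it identifies `A₊` with its dual cone, is
invariant under reversible transformations, takes values in `[0, 1]` on states, is `1` on the
diagonal exactly at the pure states, and makes perfectly distinguishable states orthogonal. -/
structure IsSelfDualizing (S : DynamicalStateSpace A) (B : LinearMap.BilinForm ℝ A) : Prop where
  symm : ∀ x y, B x y = B y x
  pos : ∀ x, x ≠ 0 → 0 < B x x
  self_dual : ∀ f : Module.Dual ℝ A, (∀ w ∈ S.Aplus, 0 ≤ f w) ↔ ∃ x ∈ S.Aplus, f = B x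
  invariant : ∀ T ∈ S.𝒢, ∀ x y, B (T x) (T y) = B x y
  mem_Icc : ∀ w ∈ S.Ω, ∀ v ∈ S.Ω, B w v ∈ Set.Icc (0 : ℝ) 1
  pure : ∀ w, S.IsPure w → B w w = 1
  mixed : ∀ w ∈ S.Ω, ¬ S.IsPure w → B w w < 1
  orthogonal : ∀ w v : A, S.PerfectlyDistinguishable ![w, v] → B w v = 0

end DynamicalStateSpace

/-- The Shannon entropy (base 2); `0 log 0 = 0` holds since `Real.logb 2 0 = 0`. -/
noncomputable def shannonEntropy {n : ℕ} (p : Fin n → ℝ) : ℝ :=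
  -∑ j, p j * Real.logb 2 (p j)

open Classical in
/-- The Rényi entropy of order `α ∈ [0, ∞]` (base 2) of a probability vector. -/
noncomputable def renyiEntropy {n : ℕ} (α : ℝ≥0∞) (p : Fin n → ℝ) : ℝ :=
  if α = 0 then Real.logb 2 (Finset.card {j | 0 < p j})
  else if α = 1 then shannonEntropy p
  else if α = ∞ then -Real.logb 2 (⨆ j, p j)
  else 1 / (1 - α.toReal) * Real.logb 2 (∑ j, p j ^ α.toReal)

/-- The vector `(p, 0, …, 0)` with `N` entries, for `n ≤ N`. -/
def padZero {n : ℕ} (N : ℕ) (p : Fin n → ℝ) : Fin N → ℝ :=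
  fun i => if h : (i : ℕ) < n then p ⟨i, h⟩ else 0

namespace DynamicalStateSpace

variable {A : Type*} [NormedAddCommGroup A] [NormedSpace ℝ A] [FiniteDimensional ℝ A]

/-- The order-`α` Rényi entropies of the outcome distributions of all fine-grained measurements on
the state `w`. -/
def outcomeRenyi (S : DynamicalStateSpace A) (α : ℝ≥0∞) (w : A) : Set ℝ :=
  {h | ∃ (N : ℕ) (e : Fin N → Module.Dual ℝ A),
    S.IsFineGrained e ∧ h = renyiEntropy α (fun j => e j w)}

/-- The order-`α` Rényi measurement entropy. -/
noncomputable def renyiMeasurementEntropy (S : DynamicalStateSpace A) (α : ℝ≥0∞) (w : A) : ℝ :=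
  sInf (S.outcomeRenyi α w)

/-- The measurement entropy: the infimum of the Shannon entropies of the outcome distributions of
all fine-grained measurements. -/
noncomputable def measurementEntropy (S : DynamicalStateSpace A) (w : A) : ℝ :=
  sInf {h | ∃ (N : ℕ) (e : Fin N → Module.Dual ℝ A),
    S.IsFineGrained e ∧ h = shannonEntropy (fun j => e j w)}

end DynamicalStateSpace

/-! The reversible group is bounded, so it fixes a state `μ` and an inner product. By strong
symmetry the invariant inner product, corrected along `u`, takes one value on all pure states and
one on all pairs from a frame. Decomposing `μ` classically fixes the ratio of these values and
forces equal weights, so a rescaling makes every frame orthonormal and represents `u` by the sum of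
a `d`-frame (`exists_isSpectralForm`).

This yields Euclidean spectral theory: frames extend to `d`-frames, every vector is a combination of
one, the cone is self-dual, and all effects are allowed. Fine-grained effects are then multiples `c
• B v` of pure states, the weights summing to `d`.

Such a measurement applied to `∑ pⱼ vⱼ` acts on `p` through the overlaps `c i * B (y i) (z j)`,
which complete to a doubly stochastic matrix (`exists_doublyStochastic`). Rényi entropies are Schur
concave, so no fine-grained measurement goes below the entropy of `p`; measuring in a `d`-frame
extending `v` attains it (`isLeast_outcomeRenyi`). -/

/-! ### Fixed points of bounded linear groups -/

/-- A bounded group of linear maps of a finite-dimensional space has a fixed point in the closed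
convex hull of each orbit. -/
theorem exists_fixedPoint_of_bounded_group {V : Type*} [NormedAddCommGroup V] [NormedSpace ℝ V]
    [FiniteDimensional ℝ V] (G : Set (V →ₗ[ℝ] V)) (hone : LinearMap.id ∈ G)
    (hmul : ∀ S ∈ G, ∀ T ∈ G, S ∘ₗ T ∈ G) (hinv : ∀ T ∈ G, ∃ S ∈ G, ∀ x, S (T x) = x)
    (M : ℝ) (hM : ∀ T ∈ G, ∀ x, ‖T x‖ ≤ M * ‖x‖) (x₀ : V) :
    ∃ x ∈ closure (convexHull ℝ ((fun T : V →ₗ[ℝ] V => T x₀) '' G)), ∀ T ∈ G, T x = x := by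
  set O : Set V := (fun T : V →ₗ[ℝ] V => T x₀) '' G with hO
  set C : Set V := closure (convexHull ℝ O) with hC
  have : ProperSpace V := FiniteDimensional.proper ℝ V
  have hOb : Bornology.IsBounded O := by
    refine isBounded_iff_forall_norm_le.2 ⟨M * ‖x₀‖, ?_⟩
    rintro _ ⟨T, hT, rfl⟩
    exact hM T hT x₀
  have hCc : IsCompact C := (isBounded_convexHull.2 hOb).isCompact_closure
  have hCconv : Convex ℝ C := (convex_convexHull ℝ O).closure
  have hCne : C.Nonempty := ⟨x₀, subset_closure (subset_convexHull ℝ O ⟨_, hone, rfl⟩)⟩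
  have hCinv : ∀ T ∈ G, ∀ x ∈ C, T x ∈ C := by
    intro T hT x hx
    have hcont : Continuous T := T.continuous_of_finiteDimensional
    have h1 : T x ∈ closure (T '' convexHull ℝ O) :=
      image_closure_subset_closure_image hcont ⟨x, hx, rfl⟩
    refine closure_mono ?_ h1
    rw [LinearMap.image_convexHull]
    refine convexHull_mono ?_
    rintro _ ⟨_, ⟨S, hS, rfl⟩, rfl⟩
    exact ⟨T ∘ₗ S, hmul T hT S hS, rfl⟩
  -- The norm of `V` need not satisfy the parallelogram law, so orbits are measured in Euclidean
  -- coordinates. `N` does not increase along the group, and a minimizer on `C` turns out to be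
  -- fixed.
  let φ : V ≃L[ℝ] EuclideanSpace ℝ (Fin (Module.finrank ℝ V)) := toEuclidean
  let N : V → ℝ := fun x => ⨆ T : G, ‖φ ((T : V →ₗ[ℝ] V) x)‖ ^ 2
  have hGne : Nonempty G := ⟨⟨_, hone⟩⟩
  obtain ⟨L, hL0, hL⟩ := (φ : V →L[ℝ] EuclideanSpace ℝ (Fin (Module.finrank ℝ V))).bound
  obtain ⟨L', hL'0, hL'⟩ :=
    (φ.symm : EuclideanSpace ℝ (Fin (Module.finrank ℝ V)) →L[ℝ] V).bound
  have hbdd : ∀ x, BddAbove (Set.range fun T : G => ‖φ ((T : V →ₗ[ℝ] V) x)‖ ^ 2) := by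
    intro x
    refine ⟨(L * (M * ‖x‖)) ^ 2, ?_⟩
    rintro _ ⟨T, rfl⟩
    have h1 : ‖φ ((T : V →ₗ[ℝ] V) x)‖ ≤ L * (M * ‖x‖) :=
      (hL _).trans (mul_le_mul_of_nonneg_left (hM T T.2 x) hL0.le)
    exact pow_le_pow_left₀ (norm_nonneg _) h1 2
  have hlsc : LowerSemicontinuous N := by
    refine lowerSemicontinuous_ciSup hbdd fun T => Continuous.lowerSemicontinuous ?_
    have hcont : Continuous (T : V →ₗ[ℝ] V) := (T : V →ₗ[ℝ] V).continuous_of_finiteDimensional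
    exact ((φ.continuous.comp hcont).norm).pow 2
  obtain ⟨x, hxC, hx⟩ := (hlsc.lowerSemicontinuousOn C).exists_isMinOn hCne hCc
  refine ⟨x, hxC, fun T hT => ?_⟩
  have hNT : N (T x) ≤ N x :=
    ciSup_le fun S => le_ciSup (hbdd x) (⟨(S : V →ₗ[ℝ] V) ∘ₗ T, hmul S S.2 T hT⟩ : G)
  set y := T x with hy
  have hyC : y ∈ C := hCinv T hT x hxC
  set m : V := (1 / 2 : ℝ) • x + (1 / 2 : ℝ) • y with hm
  have hmC : m ∈ C := hCconv hxC hyC (by norm_num) (by norm_num) (by norm_num)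
  have hmin : N x ≤ N m := hx hmC
  by_contra hne
  have hpos : 0 < ‖x - y‖ := norm_pos_iff.2 (sub_ne_zero.2 (Ne.symm hne))
  -- Inverses are bounded too, so `S x` and `S y` stay apart uniformly in `S`. The parallelogram
  -- gain at the midpoint therefore survives the supremum.
  have hlow : ∀ S ∈ G, ‖x - y‖ ≤ |M| * L' * ‖φ (S (x - y))‖ := by
    intro S hS
    obtain ⟨R, hR, hRS⟩ := hinv S hS
    have h1 : ‖x - y‖ ≤ M * ‖S (x - y)‖ := by
      have := hM R hR (S (x - y))
      rwa [hRS] at this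
    have h2 : ‖S (x - y)‖ ≤ L' * ‖φ (S (x - y))‖ := by
      simpa using hL' (φ (S (x - y)))
    calc ‖x - y‖ ≤ |M| * ‖S (x - y)‖ :=
          h1.trans (mul_le_mul_of_nonneg_right (le_abs_self M) (norm_nonneg _))
      _ ≤ |M| * (L' * ‖φ (S (x - y))‖) := mul_le_mul_of_nonneg_left h2 (abs_nonneg _)
      _ = _ := by ring
  have hML : 0 < |M| * L' := by
    by_contra hcon
    have := hlow _ hone
    nlinarith [norm_nonneg (φ ((LinearMap.id : V →ₗ[ℝ] V) (x - y)))]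
  set δ : ℝ := (‖x - y‖ / (|M| * L')) ^ 2 with hδ
  have hδpos : 0 < δ := by positivity
  have hNm : N m ≤ N x - δ / 4 := by
    refine ciSup_le fun S => ?_
    have h1 : ‖φ ((S : V →ₗ[ℝ] V) x)‖ ^ 2 ≤ N x := le_ciSup (hbdd x) S
    have h2 : ‖φ ((S : V →ₗ[ℝ] V) y)‖ ^ 2 ≤ N x := (le_ciSup (hbdd y) S).trans hNT
    have h3 : δ ≤ ‖φ ((S : V →ₗ[ℝ] V) x) - φ ((S : V →ₗ[ℝ] V) y)‖ ^ 2 := by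
      rw [hδ, ← map_sub, ← map_sub]
      refine pow_le_pow_left₀ (by positivity) ?_ 2
      rw [div_le_iff₀ hML, mul_comm]
      exact hlow S S.2
    have h4 := parallelogram_law_with_norm ℝ (φ ((S : V →ₗ[ℝ] V) x)) (φ ((S : V →ₗ[ℝ] V) y))
    have h5 : φ ((S : V →ₗ[ℝ] V) m)
        = (1 / 2 : ℝ) • (φ ((S : V →ₗ[ℝ] V) x) + φ ((S : V →ₗ[ℝ] V) y)) := by
      simp [hm]
    rw [h5, norm_smul, mul_pow]
    norm_num
    nlinarith
  linarith

/-! ### States, frames and the action of the reversible group -/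

namespace AbstractStateSpace

variable {A : Type*} [NormedAddCommGroup A] [NormedSpace ℝ A] [FiniteDimensional ℝ A]

theorem subset_Aplus (S : AbstractStateSpace A) : S.Ω ⊆ S.Aplus :=
  fun w hw => ⟨1, zero_le_one, w, hw, (one_smul ℝ w).symm⟩

theorem unit_eq_one (S : AbstractStateSpace A) {w : A} (hw : w ∈ S.Ω) : S.u w = 1 :=
  (S.unit_eq_one_iff w (S.subset_Aplus hw)).2 hw

theorem nonempty (S : AbstractStateSpace A) : S.Ω.Nonempty := by
  obtain ⟨_, r, hr, w, hw, rfl⟩ := S.cone.nonempty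
  exact ⟨w, hw⟩

theorem span_eq_top (S : AbstractStateSpace A) : Submodule.span ℝ S.Ω = ⊤ := by
  rw [eq_top_iff, ← S.cone_generating, Submodule.span_le]
  rintro _ ⟨r, hr, w, hw, rfl⟩
  exact Submodule.smul_mem _ _ (Submodule.subset_span hw)

theorem smul_mem_Aplus (S : AbstractStateSpace A) {r : ℝ} (hr : 0 ≤ r) {x : A} (hx : x ∈ S.Aplus) :
    r • x ∈ S.Aplus := S.cone.smul_mem r hr x hx

theorem add_mem_Aplus (S : AbstractStateSpace A) {x y : A} (hx : x ∈ S.Aplus) (hy : y ∈ S.Aplus) :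
    x + y ∈ S.Aplus := S.cone.add_mem x hx y hy

theorem sum_mem_Aplus (S : AbstractStateSpace A) {ι : Type*} (s : Finset ι) (f : ι → A)
    (hf : ∀ i ∈ s, f i ∈ S.Aplus) : ∑ i ∈ s, f i ∈ S.Aplus := by
  classical
  induction s using Finset.induction_on with
  | empty =>
    obtain ⟨x, hx⟩ := S.cone.nonempty
    simpa using S.smul_mem_Aplus le_rfl hx
  | insert a s ha ih =>
    rw [Finset.sum_insert ha]
    exact S.add_mem_Aplus (hf a (Finset.mem_insert_self a s))
      (ih fun i hi => hf i (Finset.mem_insert_of_mem hi))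

end AbstractStateSpace

namespace DynamicalStateSpace

variable {A : Type*} [NormedAddCommGroup A] [NormedSpace ℝ A] [FiniteDimensional ℝ A]

/-- Neither `T` nor its inverse increases `u` on states, and the states span `A`. -/
theorem unit_map (S : DynamicalStateSpace A) {T : A ≃ₗ[ℝ] A} (hT : T ∈ S.𝒢) (x : A) :
    S.u (T x) = S.u x := by
  have h : S.u ∘ₗ (T : A →ₗ[ℝ] A) = S.u := by
    refine LinearMap.ext_on S.span_eq_top fun w hw => ?_
    have hw' := S.subset_Aplus hw
    refine le_antisymm ((S.isTransformation T hT).2 w hw') ?_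
    have h1 := (S.isTransformation T⁻¹ (S.𝒢.inv_mem hT)).2 (T w)
      ((S.isTransformation T hT).1 w hw')
    simpa using h1
  exact LinearMap.congr_fun h x

theorem map_mem (S : DynamicalStateSpace A) {T : A ≃ₗ[ℝ] A} (hT : T ∈ S.𝒢) {w : A}
    (hw : w ∈ S.Ω) : T w ∈ S.Ω := by
  refine (S.unit_eq_one_iff _ ((S.isTransformation T hT).1 w (S.subset_Aplus hw))).1 ?_
  exact (S.unit_map hT w).trans (S.unit_eq_one hw)

theorem isPure_map (S : DynamicalStateSpace A) {T : A ≃ₗ[ℝ] A} (hT : T ∈ S.𝒢) {w : A}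
    (hw : S.IsPure w) : S.IsPure (T w) := by
  refine ⟨S.map_mem hT hw.1, fun x hx y hy hxy => ?_⟩
  have hT' := S.𝒢.inv_mem hT
  have h := hw.2 (S.map_mem hT' hx) (S.map_mem hT' hy) ?_
  · rw [← h]; simp
  · obtain ⟨a, b, ha, hb, hab, h⟩ := hxy
    refine ⟨a, b, ha, hb, hab, T.injective ?_⟩
    simpa using h

theorem isFrame_map (S : DynamicalStateSpace A) {T : A ≃ₗ[ℝ] A} (hT : T ∈ S.𝒢) {n : ℕ}
    {w : Fin n → A} (hw : S.IsFrame w) : S.IsFrame fun j => T (w j) := by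
  obtain ⟨⟨hΩ, e, he, hsum, hδ⟩, hp⟩ := hw
  refine ⟨⟨fun j => S.map_mem hT (hΩ j), fun j => e j ∘ₗ ((T⁻¹ : A ≃ₗ[ℝ] A) : A →ₗ[ℝ] A),
    fun j => S.allowed_comp _ (S.𝒢.inv_mem hT) _ (he j), fun v hv => ?_, fun j k => ?_⟩,
    fun j => S.isPure_map hT (hp j)⟩
  · rw [← S.unit_map (S.𝒢.inv_mem hT) v]
    exact hsum _ (S.map_mem (S.𝒢.inv_mem hT) hv)
  · simpa using hδ j k

theorem PerfectlyDistinguishable.comp {S : DynamicalStateSpace A} {m n : ℕ} {w : Fin n → A}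
    (hw : S.PerfectlyDistinguishable w) {ι : Fin m → Fin n} (hι : Function.Injective ι) :
    S.PerfectlyDistinguishable (w ∘ ι) := by
  obtain ⟨hΩ, e, he, hsum, hδ⟩ := hw
  refine ⟨fun j => hΩ _, e ∘ ι, fun j => he _, fun v hv => ?_, fun j k => ?_⟩
  · refine le_trans ?_ (hsum v hv)
    have h : ∑ j, (e ∘ ι) j v = ∑ j ∈ Finset.univ.map ⟨ι, hι⟩, e j v := by simp
    rw [h]
    exact Finset.sum_le_sum_of_subset_of_nonneg (Finset.subset_univ _)
      fun j _ _ => (S.allowed_isEffect _ (he j) v (S.subset_Aplus hv)).1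
  · simp [hδ, hι.eq_iff]

theorem IsFrame.comp {S : DynamicalStateSpace A} {m n : ℕ} {w : Fin n → A}
    (hw : S.IsFrame w) {ι : Fin m → Fin n} (hι : Function.Injective ι) : S.IsFrame (w ∘ ι) :=
  ⟨hw.1.comp hι, fun _ => hw.2 _⟩

theorem IsPure.isFrame {S : DynamicalStateSpace A} {w : A} (hw : S.IsPure w) :
    S.IsFrame fun _ : Fin 1 => w :=
  ⟨⟨fun _ => hw.1, fun _ => S.u, fun _ => S.allowed_unit, fun v _ => by simp,
    fun j k => by simp [Subsingleton.elim j k, S.unit_eq_one hw.1]⟩, fun _ => hw⟩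

theorem isFrame_pair_of_isFrame {S : DynamicalStateSpace A} {n : ℕ} {w : Fin n → A}
    (hw : S.IsFrame w) {i j : Fin n} (hij : i ≠ j) : S.IsFrame ![w i, w j] := by
  have h := hw.comp (ι := ![i, j]) (by
    intro a b
    fin_cases a <;> fin_cases b <;> simp [hij, hij.symm])
  convert h using 1
  ext k
  fin_cases k <;> rfl

theorem StrongSymmetry.exists_map_eq {S : DynamicalStateSpace A} (hS : S.StrongSymmetry) {w v : A}
    (hw : S.IsPure w) (hv : S.IsPure v) : ∃ T ∈ S.𝒢, T w = v := by
  obtain ⟨T, hT, h⟩ := hS 1 _ _ (IsPure.isFrame hw) (IsPure.isFrame hv)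
  exact ⟨T, hT, h 0⟩

/-! ### Invariant state and invariant inner product -/

/-- The reversible transformations are uniformly bounded. -/
theorem exists_norm_map_le (S : DynamicalStateSpace A) :
    ∃ M : ℝ, ∀ T ∈ S.𝒢, ∀ x, ‖T x‖ ≤ M * ‖x‖ := by
  obtain ⟨R, hR⟩ := isBounded_iff_forall_norm_le.1 S.compact.isBounded
  -- In a basis made of states, the images of basis vectors stay in the bounded set `Ω`, so only the
  -- coordinates of `x` enter the estimate.
  obtain ⟨b, hbΩ, hspan, hli⟩ := exists_linearIndependent ℝ S.Ω
  have hfin : Finite b := hli.finite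
  have := Fintype.ofFinite b
  let c := Module.Basis.mk hli (by
    simp only [Subtype.range_coe_subtype, Set.ofPred_mem_eq, hspan, S.span_eq_top, le_refl])
  obtain ⟨L, hL0, hL⟩ := (LinearMap.toContinuousLinearMap (c.equivFun : A →ₗ[ℝ] (b → ℝ))).bound
  refine ⟨Fintype.card b * (L * R), fun T hT x => ?_⟩
  have hx : T x = ∑ i, c.equivFun x i • T (i : A) := by
    conv_lhs => rw [← c.sum_equivFun x]
    simp [c]
  rw [hx]
  refine (norm_sum_le _ _).trans ?_
  have h1 : ∀ i : b, ‖c.equivFun x i • T (i : A)‖ ≤ L * ‖x‖ * R := by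
    intro i
    rw [norm_smul]
    exact mul_le_mul ((norm_le_pi_norm _ i).trans (hL x)) (hR _ (S.map_mem hT (hbΩ i.2)))
      (norm_nonneg _) (by positivity)
  refine (Finset.sum_le_sum fun i _ => h1 i).trans (le_of_eq ?_)
  simp
  ring

/-- There is a state that is invariant under all reversible transformations. -/
theorem exists_invariant_state (S : DynamicalStateSpace A) :
    ∃ μ ∈ S.Ω, ∀ T ∈ S.𝒢, T μ = μ := by
  obtain ⟨M, hM⟩ := S.exists_norm_map_le
  obtain ⟨w, hw⟩ := S.nonempty
  obtain ⟨μ, hμ, hfix⟩ := exists_fixedPoint_of_bounded_group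
    {R : A →ₗ[ℝ] A | ∃ T ∈ S.𝒢, R = (T : A →ₗ[ℝ] A)} ⟨1, S.𝒢.one_mem, rfl⟩
    (by
      rintro _ ⟨T, hT, rfl⟩ _ ⟨T', hT', rfl⟩
      exact ⟨T * T', S.𝒢.mul_mem hT hT', rfl⟩)
    (by
      rintro _ ⟨T, hT, rfl⟩
      exact ⟨_, ⟨T⁻¹, S.𝒢.inv_mem hT, rfl⟩, fun x => by simp⟩)
    M (by rintro _ ⟨T, hT, rfl⟩ x; exact hM T hT x) w
  refine ⟨μ, ?_, fun T hT => hfix _ ⟨T, hT, rfl⟩⟩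
  refine closure_minimal (convexHull_min ?_ S.convex) S.compact.isClosed hμ
  rintro _ ⟨_, ⟨T, hT, rfl⟩, rfl⟩
  exact S.map_mem hT hw

/-- There is an inner product that is invariant under all reversible transformations. -/
theorem exists_invariant_form (S : DynamicalStateSpace A) :
    ∃ B : LinearMap.BilinForm ℝ A, (∀ x y, B x y = B y x) ∧ (∀ x, x ≠ 0 → 0 < B x x) ∧
      ∀ T ∈ S.𝒢, ∀ x y, B (T x) (T y) = B x y := by
  obtain ⟨M, hM⟩ := S.exists_norm_map_le
  let φ : A ≃L[ℝ] EuclideanSpace ℝ (Fin (Module.finrank ℝ A)) := toEuclidean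
  let φ' : A →L[ℝ] EuclideanSpace ℝ (Fin (Module.finrank ℝ A)) := φ
  let B₀ : A →L[ℝ] A →L[ℝ] ℝ := (innerSL ℝ).bilinearComp φ' φ'
  have hB₀ : ∀ x y, B₀ x y = inner ℝ (φ x) (φ y) := fun x y => rfl
  let τ (T : A ≃ₗ[ℝ] A) : A →L[ℝ] A := LinearMap.toContinuousLinearMap (T : A →ₗ[ℝ] A)
  let ρ (T : A ≃ₗ[ℝ] A) : (A →L[ℝ] A →L[ℝ] ℝ) →ₗ[ℝ] (A →L[ℝ] A →L[ℝ] ℝ) :=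
    { toFun := fun B => B.bilinearComp (τ T) (τ T)
      map_add' := fun B B' => by ext; simp
      map_smul' := fun c B => by ext; simp }
  have hρ : ∀ T B x y, ρ T B x y = B (T x) (T y) := fun T B x y => rfl
  obtain ⟨L, hL0, hL⟩ :=
    (φ.symm : EuclideanSpace ℝ (Fin (Module.finrank ℝ A)) →L[ℝ] A).bound
  obtain ⟨B, hB, hfix⟩ := exists_fixedPoint_of_bounded_group
    {R | ∃ T ∈ S.𝒢, R = ρ T} ⟨1, S.𝒢.one_mem, by ext; simp [hρ]⟩
    (by
      rintro _ ⟨T, hT, rfl⟩ _ ⟨T', hT', rfl⟩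
      exact ⟨T' * T, S.𝒢.mul_mem hT' hT, by ext; simp [hρ]⟩)
    (by
      rintro _ ⟨T, hT, rfl⟩
      exact ⟨_, ⟨T⁻¹, S.𝒢.inv_mem hT, rfl⟩, fun x => by ext; simp [hρ]⟩)
    (|M| * |M|) (by
      rintro _ ⟨T, hT, rfl⟩ B
      refine ContinuousLinearMap.opNorm_le_bound₂ _ (by positivity) fun x y => ?_
      rw [hρ]
      have hM' : ∀ x, ‖T x‖ ≤ |M| * ‖x‖ := fun x =>
        (hM T hT x).trans (mul_le_mul_of_nonneg_right (le_abs_self M) (norm_nonneg x))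
      calc ‖B (T x) (T y)‖ ≤ ‖B‖ * ‖T x‖ * ‖T y‖ := B.le_opNorm₂ _ _
        _ ≤ ‖B‖ * (|M| * ‖x‖) * (|M| * ‖y‖) := by
          gcongr
          · exact hM' x
          · exact hM' y
        _ = _ := by ring) B₀
  -- Definiteness is lost in closures, so it is replaced by a uniform lower bound. That bound and
  -- symmetry are closed convex conditions holding on the whole orbit of `B₀`.
  have hkey : ∀ x y, B x y = B y x ∧ ‖x‖ ^ 2 ≤ (|M| * L) ^ 2 * B x x := by
    intro x y
    let C : Set (A →L[ℝ] A →L[ℝ] ℝ) := {B | B x y = B y x ∧ ‖x‖ ^ 2 ≤ (|M| * L) ^ 2 * B x x}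
    change B ∈ C
    have hev : ∀ a b : A, Continuous fun B : A →L[ℝ] A →L[ℝ] ℝ => B a b := fun a b => by fun_prop
    refine closure_minimal (convexHull_min ?_ ?_) ?_ hB
    · rintro _ ⟨_, ⟨T, hT, rfl⟩, rfl⟩
      refine ⟨?_, ?_⟩
      · simp only [hρ, hB₀, real_inner_comm]
      · have h1 : ρ T B₀ x x = ‖φ (T x)‖ ^ 2 := by
          rw [hρ, hB₀, real_inner_self_eq_norm_sq]
        simp only [h1]
        rw [← mul_pow]
        refine pow_le_pow_left₀ (norm_nonneg _) ?_ 2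
        have h2 := hM _ (S.𝒢.inv_mem hT) (T x)
        have h3 : ‖T x‖ ≤ L * ‖φ (T x)‖ := by simpa using hL (φ (T x))
        have h4 : ‖x‖ ≤ M * ‖T x‖ := by simpa using h2
        calc ‖x‖ ≤ |M| * ‖T x‖ :=
              h4.trans (mul_le_mul_of_nonneg_right (le_abs_self M) (norm_nonneg _))
          _ ≤ |M| * (L * ‖φ (T x)‖) := mul_le_mul_of_nonneg_left h3 (abs_nonneg _)
          _ = _ := by ring
    · rintro B₁ ⟨h₁, h₁'⟩ B₂ ⟨h₂, h₂'⟩ a b ha hb hab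
      refine ⟨?_, ?_⟩
      · simp [h₁, h₂]
      · simp only [_root_.add_apply, _root_.smul_apply, smul_eq_mul]
        have : ‖x‖ ^ 2 = a * ‖x‖ ^ 2 + b * ‖x‖ ^ 2 := by rw [← add_mul, hab, one_mul]
        nlinarith
    · exact (isClosed_eq (hev x y) (hev y x)).inter
        (isClosed_le continuous_const (continuous_const.mul (hev x x)))
  refine ⟨ContinuousLinearMap.toBilinForm B, fun x y => (hkey x y).1, fun x hx => ?_,
    fun T hT x y => ?_⟩
  · have h1 := (hkey x x).2
    have h2 : 0 < ‖x‖ ^ 2 := by positivity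
    exact pos_of_mul_pos_right (h2.trans_le h1) (sq_nonneg _)
  · have h1 := hfix _ ⟨T, hT, rfl⟩
    change B (T x) (T y) = B x y
    conv_rhs => rw [← h1]
    rw [hρ]

end DynamicalStateSpace

/-! ### Zero padding -/

theorem sum_padZero {E : Type*} [AddCommMonoid E] {n N : ℕ} (h : n ≤ N) (p : Fin n → ℝ)
    (F : Fin N → ℝ → E) (hF : ∀ j, F j 0 = 0) :
    ∑ j, F j (padZero N p j) = ∑ i, F (Fin.castLE h i) (p i) := by
  have h1 : ∑ i, F (Fin.castLE h i) (p i)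
      = ∑ j ∈ Finset.univ.map (Fin.castLEEmb h), F j (padZero N p j) := by
    simp [padZero]
  rw [h1]
  refine (Finset.sum_subset (Finset.subset_univ _) fun j _ hj => ?_).symm
  have hj' : ¬ (j : ℕ) < n := by
    intro hlt
    refine hj (Finset.mem_map.2 ⟨⟨j, hlt⟩, Finset.mem_univ _, ?_⟩)
    ext; simp
  simp [padZero, hj', hF]

theorem padZero_nonneg {n : ℕ} {p : Fin n → ℝ} (hp : ∀ i, 0 ≤ p i) (N : ℕ) (j : Fin N) :
    0 ≤ padZero N p j := by
  unfold padZero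
  split_ifs
  · exact hp _
  · exact le_rfl

namespace DynamicalStateSpace

variable {A : Type*} [NormedAddCommGroup A] [NormedSpace ℝ A] [FiniteDimensional ℝ A]

theorem PerfectlyDistinguishable.injective {S : DynamicalStateSpace A} {n : ℕ} {w : Fin n → A}
    (hw : S.PerfectlyDistinguishable w) : Function.Injective w := by
  obtain ⟨hΩ, e, he, hsum, hδ⟩ := hw
  intro i j hij
  by_contra hne
  have h1 := hδ i i
  rw [hij, hδ i j] at h1
  simp [hne] at h1

theorem zero_mem_allowed (S : DynamicalStateSpace A) : (0 : Module.Dual ℝ A) ∈ S.allowed := by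
  simpa using S.allowed_compl _ S.allowed_unit

theorem smul_mem_allowed {S : DynamicalStateSpace A} {e : Module.Dual ℝ A}
    (he : e ∈ S.allowed) {c : ℝ} (hc0 : 0 ≤ c)
    (hc1 : c ≤ 1) : c • e ∈ S.allowed := by
  have := S.allowed_convex he (S.zero_mem_allowed) hc0 (sub_nonneg.2 hc1) (by ring)
  simpa using this

/-! ### Construction of the spectral form -/

/-- An invariant inner product for which frames are orthonormal and the order unit is represented by
the sum of the states of a frame of size `d`. -/
structure IsSpectralForm (S : DynamicalStateSpace A) (B : LinearMap.BilinForm ℝ A) (d : ℕ) :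
    Prop where
  symm : ∀ x y, B x y = B y x
  pos : ∀ x, x ≠ 0 → 0 < B x x
  invariant : ∀ T ∈ S.𝒢, ∀ x y, B (T x) (T y) = B x y
  pure : ∀ w, S.IsPure w → B w w = 1
  orthogonal : ∀ (n : ℕ) (v : Fin n → A), S.IsFrame v → ∀ i j, i ≠ j → B (v i) (v j) = 0
  exists_frame : ∃ w : Fin d → A, S.IsFrame w ∧ ∀ x, S.u x = ∑ j, B (w j) x

/-- `K` is the invariant form after projecting along `μ`, so it annihilates `μ`. With `r` its value
on pure states and `c` on frame pairs, pairing `μ = ∑ pⱼ wⱼ` with `wᵢ` gives `pᵢ r + (1 - pᵢ) c =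
0`. Hence `pᵢ = 1/n` and `r = -(n-1)c`, and `K / (r - c) + u ⊗ u / n` is `1` on pure states and `0`
on frame pairs. That `n` is the maximal frame size follows only later, from Bessel's inequality. -/
theorem exists_isSpectralForm (S : DynamicalStateSpace A) (hP1 : S.ClassicalDecomposability)
    (hP2 : S.StrongSymmetry) :
    ∃ (B : LinearMap.BilinForm ℝ A) (d : ℕ), S.IsSpectralForm B d := by
  obtain ⟨μ, hμ, hμT⟩ := S.exists_invariant_state
  obtain ⟨B₀, hsymm, hpos, hinv⟩ := S.exists_invariant_form
  obtain ⟨n, p, w, hp0, hp1, hw, hμw⟩ := hP1 μ hμ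
  let P : A →ₗ[ℝ] A := LinearMap.id - S.u.smulRight μ
  have hP : ∀ x, P x = x - S.u x • μ := fun x => rfl
  let K : LinearMap.BilinForm ℝ A := B₀.compl₁₂ P P
  have hK : ∀ x y, K x y = B₀ (P x) (P y) := fun x y => rfl
  have hKsymm : ∀ x y, K x y = K y x := fun x y => hsymm _ _
  have hPT : ∀ T ∈ S.𝒢, ∀ x, P (T x) = T (P x) := by
    intro T hT x
    simp [hP, S.unit_map hT, hμT T hT]
  have hKT : ∀ T ∈ S.𝒢, ∀ x y, K (T x) (T y) = K x y := by
    intro T hT x y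
    rw [hK, hPT T hT, hPT T hT, hinv T hT, hK]
  have hKμ : ∀ y, K μ y = 0 := by
    intro y
    have : P μ = 0 := by simp [hP, S.unit_eq_one hμ]
    rw [hK, this, map_zero, LinearMap.zero_apply]
  have hB₀ : ∀ x, 0 ≤ B₀ x x := by
    intro x
    by_cases hx : x = 0
    · simp [hx]
    · exact (hpos x hx).le
  have hK0 : ∀ x, K x x = 0 → x = S.u x • μ := by
    intro x hx
    by_contra hne
    exact (hpos (P x) (sub_ne_zero.2 hne)).ne' hx
  have hn : 0 < n := by
    rcases Nat.eq_zero_or_pos n with rfl | h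
    · simp at hp1
    · exact h
  have hnR : (0 : ℝ) < n := by exact_mod_cast hn
  have key : ∃ a : ℝ, 0 < a ∧ (∀ v, S.IsPure v → a * K v v + 1 / n = 1) ∧
      (∀ (m : ℕ) (v : Fin m → A), S.IsFrame v → ∀ i j, i ≠ j → a * K (v i) (v j) + 1 / n = 0) ∧
      ∀ i, p i = 1 / n := by
    -- There are no frame pairs inside `w` here: `μ` is pure and, by transitivity, the only pure
    -- state. `K` vanishes on it, so any positive `a` would do.
    by_cases hn1 : n = 1
    · subst hn1
      have hp : ∀ i, p i = 1 := by
        intro i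
        rw [Subsingleton.elim i 0]
        simpa using hp1
      have hμ0 : μ = w 0 := by simpa [hp] using hμw
      have hpure : ∀ v, S.IsPure v → v = μ := by
        intro v hv
        obtain ⟨T, hT, h⟩ := hP2.exists_map_eq (hw.2 0) hv
        rw [← h, ← hμ0, hμT T hT]
      refine ⟨1, one_pos, fun v hv => ?_, fun m v hv i j hij => ?_, fun i => by simp [hp]⟩
      · rw [hpure v hv, hKμ]; simp
      · exact absurd (hv.1.injective ((hpure _ (hv.2 i)).trans (hpure _ (hv.2 j)).symm)) hij
    · have hn2 : 2 ≤ n := by omega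
      set i0 : Fin n := ⟨0, by omega⟩
      set i1 : Fin n := ⟨1, by omega⟩
      have h01 : i0 ≠ i1 := by simp [i0, i1]
      set r := K (w i0) (w i0) with hr
      set c := K (w i0) (w i1) with hc
      have hpure : ∀ v, S.IsPure v → K v v = r := by
        intro v hv
        obtain ⟨T, hT, h⟩ := hP2.exists_map_eq (hw.2 i0) hv
        rw [← h, hKT T hT]
      have hframe : ∀ (m : ℕ) (v : Fin m → A), S.IsFrame v → ∀ i j, i ≠ j → K (v i) (v j) = c := by
        intro m v hv i j hij
        obtain ⟨T, hT, h⟩ := hP2 2 _ _ (isFrame_pair_of_isFrame hw h01)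
          (isFrame_pair_of_isFrame hv hij)
        have h0 : T (w i0) = v i := h 0
        have h1 : T (w i1) = v j := h 1
        rw [← h0, ← h1, hKT T hT]
      have hrpos : 0 < r := by
        refine lt_of_le_of_ne (hB₀ _) fun h => ?_
        have h0 : ∀ i, w i = μ := by
          intro i
          have := hK0 (w i) ((hpure _ (hw.2 i)).trans h.symm)
          rwa [S.unit_eq_one (hw.2 i).1, one_smul] at this
        exact h01 (hw.1.injective ((h0 i0).trans (h0 i1).symm))
      have hpi : ∀ i, p i * r + (1 - p i) * c = 0 := by
        intro i
        have h1 := hKμ (w i)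
        rw [hμw, map_sum, LinearMap.sum_apply] at h1
        have h2 : ∀ j, (K (p j • w j)) (w i) = p j * c + if j = i then p i * (r - c) else 0 := by
          intro j
          rw [map_smul, LinearMap.smul_apply, smul_eq_mul]
          split_ifs with hji
          · rw [hji, hpure _ (hw.2 i)]; ring
          · rw [hframe n w hw j i hji]; ring
        simp only [h2, Finset.sum_add_distrib, ← Finset.sum_mul, hp1] at h1
        simp at h1
        linarith
      have hs : r - c ≠ 0 := by
        intro h
        have h1 := hpi i0
        have hc0 : c = 0 := by linear_combination h1 - p i0 * h
        linarith
      have hpc : ∀ i, p i = 1 / n := by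
        have h1 : ∀ i, p i = -c / (r - c) := by
          intro i
          rw [eq_div_iff hs]
          linarith [hpi i]
        have h2 : (n : ℝ) * (-c / (r - c)) = 1 := by
          rw [← hp1]
          simp [h1]
        intro i
        rw [h1 i, eq_div_iff hnR.ne', mul_comm, h2]
      have hrc : r + (n - 1) * c = 0 := by
        have h1 := hpi i0
        rw [hpc] at h1
        field_simp at h1
        linarith
      have hn2R : (2 : ℝ) ≤ n := by exact_mod_cast hn2
      have hc0 : c < 0 := by nlinarith
      have hspos : 0 < r - c := by linarith
      refine ⟨1 / (r - c), by positivity, fun v hv => ?_, fun m v hv i j hij => ?_, hpc⟩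
      · rw [hpure v hv]
        field_simp
        linarith
      · rw [hframe m v hv i j hij]
        field_simp
        linarith
  obtain ⟨a, ha, hpure, hframe, hpn⟩ := key
  let B : LinearMap.BilinForm ℝ A := a • K + (1 / n : ℝ) • S.u.smulRight S.u
  have hB : ∀ x y, B x y = a * K x y + 1 / n * (S.u x * S.u y) := fun x y => rfl
  refine ⟨B, n, ⟨fun x y => ?_, fun x hx => ?_, fun T hT x y => ?_, fun v hv => ?_,
    fun m v hv i j hij => ?_, w, hw, fun x => ?_⟩⟩
  · rw [hB, hB, hKsymm, mul_comm (S.u x)]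
  · rw [hB]
    have h1 : 0 ≤ K x x := hB₀ _
    -- The kernel of `K` is the line through `μ`, on which `u` does not vanish away from `0`.
    by_cases hu : S.u x = 0
    · have h2 : K x x ≠ 0 := by
        intro h
        have := hK0 x h
        rw [hu, zero_smul] at this
        exact hx this
      have : 0 < K x x := lt_of_le_of_ne h1 h2.symm
      rw [hu]
      simpa using mul_pos ha this
    · have : 0 < S.u x * S.u x := mul_self_pos.2 hu
      positivity
  · rw [hB, hB, hKT T hT, S.unit_map hT, S.unit_map hT]
  · rw [hB, S.unit_eq_one hv.1, one_mul, mul_one, hpure v hv]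
  · rw [hB, S.unit_eq_one (hv.2 i).1, S.unit_eq_one (hv.2 j).1, one_mul, mul_one,
      hframe m v hv i j hij]
  · have h1 : ∑ j, B (w j) x = n * B μ x := by
      rw [hμw, map_sum, LinearMap.sum_apply, Finset.mul_sum]
      refine Finset.sum_congr rfl fun j _ => ?_
      rw [hpn, map_smul, LinearMap.smul_apply, smul_eq_mul]
      field_simp
    rw [h1, hB, hKμ, S.unit_eq_one hμ]
    field_simp
    ring

/-! ### Spectral decomposition, self-duality and allowed effects -/

namespace IsSpectralForm

variable {S : DynamicalStateSpace A} {B : LinearMap.BilinForm ℝ A} {d : ℕ}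

theorem nonneg (h : S.IsSpectralForm B d) (x : A) : 0 ≤ B x x := by
  by_cases hx : x = 0
  · simp [hx]
  · exact (h.pos x hx).le

theorem injective (h : S.IsSpectralForm B d) : Function.Injective B := by
  rw [← LinearMap.ker_eq_bot, LinearMap.ker_eq_bot']
  intro x hx
  by_contra hne
  have := h.pos x hne
  rw [hx, LinearMap.zero_apply] at this
  exact lt_irrefl _ this

theorem surjective (h : S.IsSpectralForm B d) : Function.Surjective B := by
  have hf : Module.finrank ℝ A = Module.finrank ℝ (Module.Dual ℝ A) :=
    (Subspace.dual_finrank_eq).symm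
  exact (LinearMap.injective_iff_surjective_of_finrank_eq_finrank hf).1 h.injective

theorem apply_frame (h : S.IsSpectralForm B d) {n : ℕ} {v : Fin n → A} (hv : S.IsFrame v)
    (i j : Fin n) : B (v i) (v j) = if i = j then 1 else 0 := by
  split_ifs with hij
  · rw [hij, h.pure _ (hv.2 j)]
  · exact h.orthogonal n v hv i j hij

theorem apply_sum_frame (h : S.IsSpectralForm B d) {n : ℕ} {v : Fin n → A} (hv : S.IsFrame v)
    (q : Fin n → ℝ) (i : Fin n) : B (v i) (∑ j, q j • v j) = q i := by
  simp [map_sum, h.apply_frame hv]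

theorem invariant_left (h : S.IsSpectralForm B d) {T : A ≃ₗ[ℝ] A} (hT : T ∈ S.𝒢) (x y : A) :
    B (T x) y = B x ((T⁻¹ : A ≃ₗ[ℝ] A) y) := by
  conv_lhs => rw [show y = T ((T⁻¹ : A ≃ₗ[ℝ] A) y) by simp]
  exact h.invariant T hT _ _

/-- Strong symmetry carries the given `d`-frame to `v`, and `u` is invariant. -/
theorem unit_eq_sum (h : S.IsSpectralForm B d) (hP2 : S.StrongSymmetry) {v : Fin d → A}
    (hv : S.IsFrame v) (x : A) : S.u x = ∑ j, B (v j) x := by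
  obtain ⟨w, hw, hu⟩ := h.exists_frame
  obtain ⟨T, hT, hTw⟩ := hP2 d w v hw hv
  simp only [← hTw, h.invariant_left hT, ← hu, S.unit_map (S.𝒢.inv_mem hT)]

theorem unit_eq (h : S.IsSpectralForm B d) (hP2 : S.StrongSymmetry) {v : Fin d → A}
    (hv : S.IsFrame v) : B (∑ j, v j) = S.u := by
  ext x
  rw [map_sum, LinearMap.sum_apply, h.unit_eq_sum hP2 hv]

theorem sum_frame_eq (h : S.IsSpectralForm B d) (hP2 : S.StrongSymmetry) {v v' : Fin d → A}
    (hv : S.IsFrame v) (hv' : S.IsFrame v') : ∑ j, v j = ∑ j, v' j :=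
  h.injective ((h.unit_eq hP2 hv).trans (h.unit_eq hP2 hv').symm)

theorem unit_sum_frame {n : ℕ} {v : Fin n → A} (hv : S.IsFrame v) : S.u (∑ j, v j) = n := by
  rw [map_sum, Finset.sum_congr rfl fun j _ => S.unit_eq_one (hv.2 j).1]
  simp

/-- Bessel's inequality for the representative of the order unit. -/
theorem card_le (h : S.IsSpectralForm B d) (hP2 : S.StrongSymmetry) {n : ℕ} {v : Fin n → A}
    (hv : S.IsFrame v) : n ≤ d := by
  obtain ⟨w, hw, hu⟩ := h.exists_frame
  have h1 := h.nonneg (∑ j, w j - ∑ j, v j)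
  have h2 : B (∑ j, v j) (∑ j, v j) = n := by
    have : ∀ i, B (v i) (∑ j, v j) = 1 := by
      intro i
      simpa using h.apply_sum_frame hv (fun _ => 1) i
    rw [LinearMap.map_sum₂, Finset.sum_congr rfl fun i _ => this i]
    simp
  have h3 : B (∑ j, v j) (∑ j, w j) = n := by
    rw [h.symm, h.unit_eq hP2 hw, unit_sum_frame hv]
  rw [LinearMap.map_sub₂, map_sub, map_sub, h2, h3, h.unit_eq hP2 hw,
    unit_sum_frame hv, unit_sum_frame hw] at h1
  have : (n : ℝ) ≤ d := by linarith
  exact_mod_cast this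

theorem isMaxFrameSize (h : S.IsSpectralForm B d) (hP2 : S.StrongSymmetry) :
    S.IsMaxFrameSize d := by
  obtain ⟨w, hw, -⟩ := h.exists_frame
  exact ⟨⟨w, hw⟩, fun n ⟨v, hv⟩ => h.card_le hP2 hv⟩

/-- A transformation taking the first `n` members of some `d`-frame to `v` takes the whole `d`-frame
to an extension of `v`. -/
theorem exists_extend (h : S.IsSpectralForm B d) (hP2 : S.StrongSymmetry) {n : ℕ} {v : Fin n → A}
    (hv : S.IsFrame v) : ∃ v' : Fin d → A, S.IsFrame v' ∧
      ∀ q : Fin n → ℝ, ∑ j, q j • v j = ∑ j, padZero d q j • v' j := by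
  have hnd := h.card_le hP2 hv
  obtain ⟨w, hw, -⟩ := h.exists_frame
  obtain ⟨T, hT, hTw⟩ := hP2 n (w ∘ Fin.castLE hnd) v (hw.comp (Fin.castLE_injective hnd)) hv
  refine ⟨fun j => T (w j), S.isFrame_map hT hw, fun q => ?_⟩
  rw [sum_padZero hnd q (fun j t => t • T (w j)) (fun j => zero_smul _ _)]
  exact Finset.sum_congr rfl fun j _ => by rw [← hTw j]; rfl

theorem exists_decomposition_of_mem (h : S.IsSpectralForm B d) (hP1 : S.ClassicalDecomposability)
    (hP2 : S.StrongSymmetry) {x : A} (hx : x ∈ S.Aplus) :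
    ∃ (q : Fin d → ℝ) (v : Fin d → A), S.IsFrame v ∧ (∀ j, 0 ≤ q j) ∧ x = ∑ j, q j • v j := by
  obtain ⟨r, hr, w, hw, rfl⟩ := hx
  obtain ⟨n, p, v, hp0, hp1, hv, rfl⟩ := hP1 w hw
  obtain ⟨v', hv', hsum⟩ := h.exists_extend hP2 hv
  refine ⟨fun j => r * padZero d p j, v', hv', fun j => mul_nonneg hr (padZero_nonneg hp0 d j), ?_⟩
  rw [hsum, Finset.smul_sum]
  simp only [mul_smul]

theorem sum_smul_mem {n : ℕ} {v : Fin n → A} (hv : S.IsFrame v) {q : Fin n → ℝ}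
    (hq : ∀ j, 0 ≤ q j) : ∑ j, q j • v j ∈ S.Aplus :=
  S.sum_mem_Aplus _ _ fun j _ => S.smul_mem_Aplus (hq j) (S.subset_Aplus (hv.2 j).1)

/-- Every vector has a spectral decomposition. -/
theorem exists_decomposition (h : S.IsSpectralForm B d) (hP1 : S.ClassicalDecomposability)
    (hP2 : S.StrongSymmetry) (x : A) :
    ∃ (q : Fin d → ℝ) (v : Fin d → A), S.IsFrame v ∧ x = ∑ j, q j • v j := by
  obtain ⟨w, hw, -⟩ := h.exists_frame
  set y := ∑ j, w j with hy
  have hyA : y ∈ S.Aplus := S.sum_mem_Aplus _ _ fun j _ => S.subset_Aplus (hw.2 j).1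
  -- `y` is an order unit equal to the sum of every `d`-frame. Shifting `x` by `t • y` into the cone
  -- thus only shifts its coefficients by `t`. The statement about `-x` serves the induction through
  -- negative scalars.
  have key : ∃ t : ℝ, x + t • y ∈ S.Aplus ∧ -x + t • y ∈ S.Aplus := by
    have hx : x ∈ Submodule.span ℝ S.Aplus := by
      have := S.cone_generating
      unfold AbstractStateSpace.Aplus
      rw [this]
      trivial
    induction hx using Submodule.span_induction with
    | mem x hx =>
      obtain ⟨q, v, hv, hq, hxq⟩ := h.exists_decomposition_of_mem hP1 hP2 hx
      refine ⟨∑ j, q j, S.add_mem_Aplus hx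
        (S.smul_mem_Aplus (Finset.sum_nonneg fun j _ => hq j) hyA), ?_⟩
      have : -x + (∑ j, q j) • y = ∑ i, (∑ j, q j - q i) • v i := by
        rw [hy, h.sum_frame_eq hP2 hw hv, hxq, Finset.smul_sum]
        simp only [sub_smul, Finset.sum_sub_distrib]
        abel
      rw [this]
      exact sum_smul_mem hv fun i => sub_nonneg.2
        (Finset.single_le_sum (fun j _ => hq j) (Finset.mem_univ i))
    | zero =>
      refine ⟨1, ?_, ?_⟩ <;> simpa using hyA
    | add a b _ _ ha hb =>
      obtain ⟨s, hs, hs'⟩ := ha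
      obtain ⟨t, ht, ht'⟩ := hb
      refine ⟨s + t, ?_, ?_⟩
      · convert S.add_mem_Aplus hs ht using 1
        module
      · convert S.add_mem_Aplus hs' ht' using 1
        module
    | smul r a _ ha =>
      obtain ⟨s, hs, hs'⟩ := ha
      rcases le_total 0 r with hr | hr
      · refine ⟨r * s, ?_, ?_⟩
        · convert S.smul_mem_Aplus hr hs using 1
          module
        · convert S.smul_mem_Aplus hr hs' using 1
          module
      · have hr' : 0 ≤ -r := neg_nonneg.2 hr
        refine ⟨-r * s, ?_, ?_⟩
        · convert S.smul_mem_Aplus hr' hs' using 1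
          module
        · convert S.smul_mem_Aplus hr' hs using 1
          module
  obtain ⟨t, ht, -⟩ := key
  obtain ⟨q, v, hv, hq, hxq⟩ := h.exists_decomposition_of_mem hP1 hP2 ht
  refine ⟨fun j => q j - t, v, hv, ?_⟩
  simp only [sub_smul, Finset.sum_sub_distrib]
  rw [← hxq, ← Finset.smul_sum, h.sum_frame_eq hP2 hv hw]
  simp [hy]

/-- The dual cone is contained in the cone of states. -/
theorem mem_of_nonneg (h : S.IsSpectralForm B d) (hP1 : S.ClassicalDecomposability)
    (hP2 : S.StrongSymmetry) {x : A} (hx : ∀ w ∈ S.Aplus, 0 ≤ B x w) : x ∈ S.Aplus := by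
  obtain ⟨q, v, hv, rfl⟩ := h.exists_decomposition hP1 hP2 x
  refine sum_smul_mem hv fun j => ?_
  have := hx (v j) (S.subset_Aplus (hv.2 j).1)
  rwa [h.symm, h.apply_sum_frame hv] at this

/-- In an orthonormal frame `B w w` is `∑ pᵢ²`. -/
theorem self_le (h : S.IsSpectralForm B d) (hP1 : S.ClassicalDecomposability)
    {w : A} (hw : w ∈ S.Ω) : B w w ≤ 1 := by
  obtain ⟨n, p, v, hp0, hp1, hv, rfl⟩ := hP1 w hw
  rw [LinearMap.map_sum₂, ← hp1]
  refine Finset.sum_le_sum fun i _ => ?_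
  rw [map_smul, LinearMap.smul_apply, h.apply_sum_frame hv, smul_eq_mul]
  have : p i ≤ 1 := by
    rw [← hp1]
    exact Finset.single_le_sum (fun j _ => hp0 j) (Finset.mem_univ i)
  exact mul_le_of_le_one_right (hp0 i) this

/-- The functional represented by a pure state is an allowed effect. -/
theorem allowed_of_isPure (h : S.IsSpectralForm B d) (hP1 : S.ClassicalDecomposability)
    (hP2 : S.StrongSymmetry) {v : A} (hv : S.IsPure v) : B v ∈ S.allowed := by
  obtain ⟨w, hw, hu⟩ := h.exists_frame
  have hd : 1 ≤ d := h.card_le hP2 (IsPure.isFrame hv)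
  set i : Fin d := ⟨0, hd⟩
  -- The representative `x` of the distinguishing effect `e i` is a state, since `u x = ∑ j, e i (w
  -- j) = 1`. With `B x (w i) = 1` and `B x x ≤ 1`, this forces `x = w i`; the group then carries
  -- the result to every pure state.
  obtain ⟨hΩ, e, he, hsum, hδ⟩ := hw.1
  obtain ⟨x, hx⟩ := h.surjective (e i)
  have hxA : x ∈ S.Aplus := h.mem_of_nonneg hP1 hP2 fun y hy => by
    rw [hx]; exact (S.allowed_isEffect _ (he i) y hy).1
  have hux : S.u x = 1 := by
    rw [hu, Finset.sum_congr rfl fun j _ => h.symm (w j) x]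
    simp [hx, hδ]
  have hxΩ : x ∈ S.Ω := (S.unit_eq_one_iff x hxA).1 hux
  have hxw : B x (w i) = 1 := by simp [hx, hδ]
  have hwx : B (w i) x = 1 := (h.symm _ _).trans hxw
  have heq : x = w i := by
    by_contra hne
    have h1 := h.pos (x - w i) (sub_ne_zero.2 hne)
    rw [LinearMap.map_sub₂, map_sub, map_sub, hxw, hwx, h.pure _ (hw.2 i)] at h1
    linarith [h.self_le hP1 hxΩ]
  obtain ⟨T, hT, hTw⟩ := hP2.exists_map_eq (hw.2 i) hv
  have h2 : B v = e i ∘ₗ ((T⁻¹ : A ≃ₗ[ℝ] A) : A →ₗ[ℝ] A) := by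
    ext y
    rw [← hTw, h.invariant_left hT, ← heq, hx]
    rfl
  rw [h2]
  exact S.allowed_comp _ (S.𝒢.inv_mem hT) _ (he i)

theorem nonneg_of_mem (h : S.IsSpectralForm B d) (hP1 : S.ClassicalDecomposability)
    (hP2 : S.StrongSymmetry) {x y : A} (hx : x ∈ S.Aplus) (hy : y ∈ S.Aplus) : 0 ≤ B x y := by
  obtain ⟨q, v, hv, hq, rfl⟩ := h.exists_decomposition_of_mem hP1 hP2 hx
  rw [map_sum, LinearMap.sum_apply]
  refine Finset.sum_nonneg fun j _ => ?_
  rw [map_smul, LinearMap.smul_apply]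
  exact mul_nonneg (hq j)
    (S.allowed_isEffect _ (h.allowed_of_isPure hP1 hP2 (hv.2 j)) y hy).1

/-- Every effect is allowed. -/
theorem allowed_of_isEffect (h : S.IsSpectralForm B d) (hP1 : S.ClassicalDecomposability)
    (hP2 : S.StrongSymmetry) {e : Module.Dual ℝ A} (he : S.IsEffect e) : e ∈ S.allowed := by
  obtain ⟨x, rfl⟩ := h.surjective e
  obtain ⟨q, v, hv, rfl⟩ := h.exists_decomposition hP1 hP2 x
  have hq : ∀ j, 0 ≤ q j ∧ q j ≤ 1 := by
    intro j
    have h1 := he (v j) (S.subset_Aplus (hv.2 j).1)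
    rwa [h.symm, h.apply_sum_frame hv, S.unit_eq_one (hv.2 j).1] at h1
  -- Coefficients at most `1` keep every partial sum below `u = ∑ B (v j)`, as closure of the
  -- allowed effects under addition requires.
  have key : ∀ s : Finset (Fin d), B (∑ j ∈ s, q j • v j) ∈ S.allowed := by
    intro s
    induction s using Finset.induction_on with
    | empty => simpa using S.zero_mem_allowed
    | insert a s ha ih =>
      rw [Finset.sum_insert ha, map_add]
      refine S.allowed_add _ ?_ _ ih fun w hw => ?_
      · rw [map_smul]
        exact smul_mem_allowed (h.allowed_of_isPure hP1 hP2 (hv.2 a)) (hq a).1 (hq a).2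
      · rw [← LinearMap.add_apply, ← map_add, ← Finset.sum_insert (f := fun j => q j • v j) ha,
          h.unit_eq_sum hP2 hv, LinearMap.map_sum₂]
        have h0 : ∀ j, 0 ≤ B (v j) w := fun j =>
          h.nonneg_of_mem hP1 hP2 (S.subset_Aplus (hv.2 j).1) (S.subset_Aplus hw)
        refine (Finset.sum_le_sum fun j _ => ?_).trans
          (Finset.sum_le_sum_of_subset_of_nonneg (Finset.subset_univ _) fun j _ _ => h0 j)
        rw [map_smul, LinearMap.smul_apply]
        exact mul_le_of_le_one_left (h0 j) (hq j).2
  exact key _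

end IsSpectralForm

end DynamicalStateSpace

/-! ### Fine-grained measurements -/

namespace DynamicalStateSpace

variable {A : Type*} [NormedAddCommGroup A] [NormedSpace ℝ A] [FiniteDimensional ℝ A]

/-- In a fine-grained measurement every effect below `e j` is proportional to `e j`. -/
theorem IsFineGrained.eq_smul {S : DynamicalStateSpace A} {N : ℕ} {e : Fin N → Module.Dual ℝ A}
    (he : S.IsFineGrained e) (j : Fin N) {f : Module.Dual ℝ A} (hf : f ∈ S.allowed)
    (hf' : e j - f ∈ S.allowed) : ∃ c : ℝ, f = c • e j := by
  have key : ∀ k, (Function.update e j (e j - f) k + if j = k then f else 0) = e k := by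
    intro k
    by_cases hk : j = k
    · subst hk; simp
    · simp [hk, Function.update_of_ne (Ne.symm hk)]
  -- The refinement splits outcome `j` into `e j - f`, kept in place, and `f`, appended as the last
  -- outcome.
  have h := he.2 (N + 1) (Fin.snoc (α := fun _ => Module.Dual ℝ A) (Function.update e j (e j - f)) f)
    (Fin.snoc (α := fun _ => Fin N) id j) ⟨?_, ?_⟩ ?_ (Fin.last N)
  · simpa using h
  · intro k
    refine Fin.lastCases ?_ (fun k => ?_) k
    · simpa using hf
    · by_cases hk : k = j
      · subst hk; simpa using hf'
      · simpa [Function.update_of_ne hk] using he.1.1 k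
  · rw [Fin.sum_univ_castSucc, ← he.1.2]
    simp only [Fin.snoc_castSucc, Fin.snoc_last]
    rw [← Finset.sum_congr rfl fun k _ => key k, Finset.sum_add_distrib]
    simp
  · intro k
    rw [Finset.sum_filter, Fin.sum_univ_castSucc]
    simp only [Fin.snoc_castSucc, Fin.snoc_last, id]
    rw [Finset.sum_ite_eq']
    simpa using key k

theorem exists_isPure (S : DynamicalStateSpace A) (hP1 : S.ClassicalDecomposability) :
    ∃ w, S.IsPure w := by
  obtain ⟨w, hw⟩ := S.nonempty
  obtain ⟨n, p, v, -, hp1, hv, -⟩ := hP1 w hw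
  rcases Nat.eq_zero_or_pos n with rfl | hn
  · simp at hp1
  · exact ⟨v ⟨0, hn⟩, hv.2 _⟩

namespace IsSpectralForm

variable {S : DynamicalStateSpace A} {B : LinearMap.BilinForm ℝ A} {d : ℕ}

theorem isSelfDualizing (h : S.IsSpectralForm B d) (hP1 : S.ClassicalDecomposability)
    (hP2 : S.StrongSymmetry) : S.IsSelfDualizing B where
  symm := h.symm
  pos := h.pos
  self_dual f := by
    constructor
    · intro hf
      obtain ⟨x, rfl⟩ := h.surjective f
      exact ⟨x, h.mem_of_nonneg hP1 hP2 hf, rfl⟩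
    · rintro ⟨x, hx, rfl⟩ w hw
      exact h.nonneg_of_mem hP1 hP2 hx hw
  invariant := h.invariant
  mem_Icc w hw v hv := by
    refine ⟨h.nonneg_of_mem hP1 hP2 (S.subset_Aplus hw) (S.subset_Aplus hv), ?_⟩
    have h1 := h.nonneg (w - v)
    rw [LinearMap.map_sub₂, map_sub, map_sub, h.symm v w] at h1
    linarith [h.self_le hP1 hw, h.self_le hP1 hv]
  pure := h.pure
  mixed w hw hwp := by
    refine lt_of_le_of_ne (h.self_le hP1 hw) fun h1 => hwp ?_
    refine ⟨hw, fun x hx y hy hxy => ?_⟩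
    obtain ⟨a, b, ha, hb, hab, hw'⟩ := hxy
    have hxx := h.self_le hP1 hx
    have hyy := h.self_le hP1 hy
    have h2 : B w w = a * a * B x x + 2 * (a * b) * B x y + b * b * B y y := by
      rw [← hw']
      simp only [map_add, LinearMap.add_apply, map_smul, LinearMap.smul_apply, smul_eq_mul,
        h.symm y x]
      ring
    have hsub : B (x - y) (x - y) = B x x - 2 * B x y + B y y := by
      rw [LinearMap.map_sub₂, map_sub, map_sub, h.symm y x]
      ring
    -- Strict convexity of the squared norm: a state of norm `1` cannot lie strictly between two
    -- distinct states of norm at most `1`.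
    have h3 : a * b * B (x - y) (x - y) = a * B x x + b * B y y - B w w := by
      obtain rfl : b = 1 - a := by linarith
      rw [h2, hsub]
      ring
    have heq : x = y := by
      by_contra hne
      have h4 := h.pos (x - y) (sub_ne_zero.2 hne)
      have h5 : 0 < a * b * B (x - y) (x - y) := by positivity
      nlinarith
    rw [← hw', ← heq, ← add_smul, hab, one_smul]
  orthogonal w v hwv := by
    obtain ⟨hΩ, e, he, hsum, hδ⟩ := hwv
    have hw : w ∈ S.Ω := hΩ 0
    have hv : v ∈ S.Ω := hΩ 1
    have h0w : e 0 w = 1 := by simpa using hδ 0 0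
    have h0v : e 0 v = 0 := by simpa using hδ 0 1
    obtain ⟨q, y, hy, hq, hwy⟩ := h.exists_decomposition_of_mem hP1 hP2 (S.subset_Aplus hw)
    obtain ⟨r, z, hz, hr, hvz⟩ := h.exists_decomposition_of_mem hP1 hP2 (S.subset_Aplus hv)
    -- `e 0` must equal `1` on each pure component of `w` of positive weight and `0` on each one of
    -- `v`. So `e 0` and `u - e 0` make any such pair a `2`-frame.
    have hpair : ∀ j k, q j * r k * B (y j) (z k) = 0 := by
      intro j k
      have hj : q j * (S.u (y j) - e 0 (y j)) = 0 := by
        have h1 : ∑ j, q j * (S.u (y j) - e 0 (y j)) = (S.u - e 0) w := by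
          conv_rhs => rw [hwy]
          simp
        rw [LinearMap.sub_apply, h0w, S.unit_eq_one hw, sub_self] at h1
        refine (Finset.sum_eq_zero_iff_of_nonneg fun j _ => mul_nonneg (hq j) (sub_nonneg.2 ?_)).1
          h1 j (Finset.mem_univ j)
        exact (S.allowed_isEffect _ (he 0) _ (S.subset_Aplus (hy.2 j).1)).2
      have hk : r k * e 0 (z k) = 0 := by
        have h1 : ∑ k, r k * e 0 (z k) = e 0 v := by
          conv_rhs => rw [hvz]
          simp
        rw [h0v] at h1
        refine (Finset.sum_eq_zero_iff_of_nonneg fun k _ => mul_nonneg (hr k) ?_).1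
          h1 k (Finset.mem_univ k)
        exact (S.allowed_isEffect _ (he 0) _ (S.subset_Aplus (hz.2 k).1)).1
      rw [S.unit_eq_one (hy.2 j).1] at hj
      rcases mul_eq_zero.1 hj with hj | hj
      · simp [hj]
      rcases mul_eq_zero.1 hk with hk | hk
      · simp [hk]
      have hframe : S.IsFrame ![y j, z k] := by
        refine ⟨⟨?_, ![e 0, S.u - e 0], ?_, fun x _ => by simp, ?_⟩, ?_⟩
        · exact Fin.forall_fin_two.2 ⟨(hy.2 j).1, (hz.2 k).1⟩
        · exact Fin.forall_fin_two.2 ⟨he 0, S.allowed_compl _ (he 0)⟩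
        · have h1 : e 0 (y j) = 1 := by linarith
          intro a b
          fin_cases a <;> fin_cases b <;>
            simp [h1, hk, S.unit_eq_one (hy.2 j).1, S.unit_eq_one (hz.2 k).1]
        · exact Fin.forall_fin_two.2 ⟨hy.2 j, hz.2 k⟩
      have h2 := h.orthogonal 2 _ hframe 0 1 (by simp)
      have h3 : B (y j) (z k) = 0 := by simpa using h2
      rw [h3, mul_zero]
    rw [hwy, hvz, LinearMap.map_sum₂]
    refine Finset.sum_eq_zero fun j _ => ?_
    rw [map_sum]
    refine Finset.sum_eq_zero fun k _ => ?_
    rw [LinearMap.map_smul₂, map_smul, smul_eq_mul, smul_eq_mul, ← mul_assoc]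
    exact hpair j k

/-- Every effect of a fine-grained measurement is a multiple of a pure state. -/
theorem exists_eq_smul (h : S.IsSpectralForm B d) (hP1 : S.ClassicalDecomposability)
    (hP2 : S.StrongSymmetry) {B' : LinearMap.BilinForm ℝ A} (hB' : S.IsSelfDualizing B') {N : ℕ}
    {e : Fin N → Module.Dual ℝ A} (he : S.IsFineGrained e) (j : Fin N) :
    ∃ c ∈ Set.Icc (0 : ℝ) 1, ∃ v, S.IsPure v ∧ e j = c • B' v := by
  have heff := S.allowed_isEffect _ (he.1.1 j)
  by_cases h0 : e j = 0
  · obtain ⟨w, hw⟩ := S.exists_isPure hP1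
    exact ⟨0, ⟨le_rfl, zero_le_one⟩, w, hw, by rw [h0, zero_smul]⟩
  -- Each term of a spectral decomposition of `x` represents an effect below `e j`, allowed because
  -- all effects are. Fine-grainedness makes any nonzero term proportional to `e j`.
  obtain ⟨x, hxA, hx⟩ := (hB'.self_dual (e j)).1 fun w hw => (heff w hw).1
  obtain ⟨q, v, hv, hq, hxv⟩ := h.exists_decomposition_of_mem hP1 hP2 hxA
  have hpos : ∀ k, ∀ w ∈ S.Aplus, 0 ≤ (q k • B' (v k)) w := fun k w hw =>
    mul_nonneg (hq k) ((hB'.self_dual _).2 ⟨v k, S.subset_Aplus (hv.2 k).1, rfl⟩ w hw)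
  have hsum : e j = ∑ k, q k • B' (v k) := by
    rw [hx, hxv, map_sum]
    simp only [map_smul]
  obtain ⟨k, hk⟩ : ∃ k, q k ≠ 0 := by
    by_contra! hcon
    exact h0 (by rw [hsum]; simp [hcon])
  have hle : ∀ w ∈ S.Aplus, (q k • B' (v k)) w ≤ e j w := by
    intro w hw
    rw [hsum, LinearMap.sum_apply]
    exact Finset.single_le_sum (f := fun k => (q k • B' (v k)) w)
      (fun i _ => hpos i w hw) (Finset.mem_univ k)
  obtain ⟨c, hc⟩ := he.eq_smul j (f := q k • B' (v k))
    (h.allowed_of_isEffect hP1 hP2 fun w hw =>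
      ⟨hpos k w hw, (hle w hw).trans (heff w hw).2⟩)
    (h.allowed_of_isEffect hP1 hP2 fun w hw =>
      ⟨sub_nonneg.2 (hle w hw), (sub_le_self _ (hpos k w hw)).trans (heff w hw).2⟩)
  have hBv : B' (v k) (v k) = 1 := hB'.pure _ (hv.2 k)
  have hc0 : c ≠ 0 := by
    rintro rfl
    have h1 := LinearMap.congr_fun hc (v k)
    simp [hBv, hk] at h1
  have hej : e j = (q k / c) • B' (v k) := by
    rw [div_eq_inv_mul, mul_smul, hc, smul_smul, inv_mul_cancel₀ hc0, one_smul]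
  refine ⟨q k / c, ?_, v k, hv.2 k, hej⟩
  have h1 := heff (v k) (S.subset_Aplus (hv.2 k).1)
  rw [S.unit_eq_one (hv.2 k).1, hej] at h1
  simpa [hBv] using h1

/-- Evaluate `u` at the sum of a `d`-frame: the left side gives `d`, and each `B (v i)` gives `u (v
i) = 1`. -/
theorem sum_coeff_eq (h : S.IsSpectralForm B d) {N : ℕ} {c : Fin N → ℝ} {v : Fin N → A}
    (hv : ∀ i, S.IsPure (v i)) (hsum : ∑ i, c i • B (v i) = S.u) : ∑ i, c i = d := by
  obtain ⟨w, hw, hu⟩ := h.exists_frame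
  have h1 := unit_sum_frame hw
  rw [← hsum, LinearMap.sum_apply] at h1
  rw [← h1]
  refine Finset.sum_congr rfl fun i _ => ?_
  rw [LinearMap.smul_apply, smul_eq_mul, map_sum, Finset.sum_congr rfl fun j _ => h.symm (v i) (w j),
    ← hu, S.unit_eq_one (hv i).1, mul_one]

/-- The pure states of a fine-grained measurement and their weights. -/
theorem exists_coeff (h : S.IsSpectralForm B d) (hP1 : S.ClassicalDecomposability)
    (hP2 : S.StrongSymmetry) {N : ℕ} {e : Fin N → Module.Dual ℝ A} (he : S.IsFineGrained e) :
    ∃ (c : Fin N → ℝ) (v : Fin N → A), (∀ i, 0 ≤ c i ∧ c i ≤ 1) ∧ (∀ i, S.IsPure (v i)) ∧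
      (∀ i, e i = c i • B (v i)) ∧ ∑ i, c i = d := by
  choose c hc v hv hev using fun j => h.exists_eq_smul hP1 hP2 (h.isSelfDualizing hP1 hP2) he j
  refine ⟨c, v, hc, hv, hev, h.sum_coeff_eq hv ?_⟩
  rw [← he.1.2]
  exact Finset.sum_congr rfl fun i _ => (hev i).symm

theorem le_of_isFineGrained (h : S.IsSpectralForm B d) (hP1 : S.ClassicalDecomposability)
    (hP2 : S.StrongSymmetry) {N : ℕ} {e : Fin N → Module.Dual ℝ A} (he : S.IsFineGrained e) :
    d ≤ N := by
  obtain ⟨c, v, hc, -, -, hsum⟩ := h.exists_coeff hP1 hP2 he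
  have h1 : ∑ i, c i ≤ ∑ _i : Fin N, (1 : ℝ) := Finset.sum_le_sum fun i _ => (hc i).2
  rw [hsum] at h1
  simp only [Finset.sum_const, Finset.card_univ, Fintype.card_fin, nsmul_eq_mul, mul_one] at h1
  exact_mod_cast h1

/-- Pure states span extremal rays of the cone of states. -/
theorem eq_smul_of_sub_mem {v x : A} (hv : S.IsPure v) (hx : x ∈ S.Aplus)
    (hvx : v - x ∈ S.Aplus) : ∃ c : ℝ, x = c • v := by
  obtain ⟨r, hr, w, hw, rfl⟩ := hx
  obtain ⟨s, hs, w', hw', hs'⟩ := hvx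
  have hv' : r • w + s • w' = v := by rw [← hs']; abel
  have hrs : r + s = 1 := by
    have h1 := S.unit_eq_one hv.1
    rw [← hv', map_add, map_smul, map_smul, S.unit_eq_one hw, S.unit_eq_one hw'] at h1
    simpa using h1
  rcases hr.eq_or_lt with rfl | hr
  · exact ⟨0, by simp⟩
  rcases hs.eq_or_lt with rfl | hs
  · refine ⟨1, ?_⟩
    rw [← hv']
    simp
  · exact ⟨r, by rw [hv.2 hw hw' ⟨r, s, hr, hs, hrs, hv'⟩]⟩

/-- A maximal frame is distinguished by the fine-grained measurement that it represents. -/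
theorem isFineGrained (h : S.IsSpectralForm B d) (hP1 : S.ClassicalDecomposability)
    (hP2 : S.StrongSymmetry) {v : Fin d → A} (hv : S.IsFrame v) :
    S.IsFineGrained fun k => B (v k) := by
  refine ⟨⟨fun k => h.allowed_of_isPure hP1 hP2 (hv.2 k), ?_⟩, fun m f M hf hfM i => ?_⟩
  · rw [← h.unit_eq hP2 hv, map_sum]
  · have hpos : ∀ i, ∀ w ∈ S.Aplus, 0 ≤ f i w := fun i w hw =>
      (S.allowed_isEffect _ (hf.1 i) w hw).1
    obtain ⟨x, hx⟩ := h.surjective (f i)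
    have hxA : x ∈ S.Aplus := h.mem_of_nonneg hP1 hP2 fun w hw => by
      rw [hx]; exact hpos i w hw
    have hvx : v (M i) - x ∈ S.Aplus := h.mem_of_nonneg hP1 hP2 fun w hw => by
      rw [LinearMap.map_sub₂, hx, show B (v (M i)) = _ from (hfM (M i)).symm, sub_nonneg,
        LinearMap.sum_apply]
      exact Finset.single_le_sum (f := fun i => f i w) (fun i _ => hpos i w hw) (by simp)
    obtain ⟨c, hc⟩ := eq_smul_of_sub_mem (hv.2 (M i)) hxA hvx
    exact ⟨c, by rw [← hx, hc, map_smul]⟩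

/-- Outcome probabilities of fine-grained measurements are bistochastic images of the spectrum. -/
theorem exists_doublyStochastic (h : S.IsSpectralForm B d) (hP1 : S.ClassicalDecomposability)
    (hP2 : S.StrongSymmetry) {w : A} {n : ℕ} {p : Fin n → ℝ} {v : Fin n → A}
    (hw : S.IsClassicalDecomposition w p v) {N : ℕ} {e : Fin N → Module.Dual ℝ A}
    (he : S.IsFineGrained e) :
    ∃ M ∈ doublyStochastic ℝ (Fin N), (fun j => e j w) = M.mulVec (padZero N p) := by
  obtain ⟨hp0, hp1, hv, rfl⟩ := hw
  obtain ⟨c, y, hc, hy, hey, hcsum⟩ := h.exists_coeff hP1 hP2 he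
  obtain ⟨z, hz, hvz⟩ := h.exists_extend hP2 hv
  have hdN := h.le_of_isFineGrained hP1 hP2 he
  have hnd := h.card_le hP2 hv
  have hsplit : ∀ F : Fin N → ℝ, ∀ (a : Fin d → ℝ) (b : ℝ),
      (∀ j : Fin N, F j = if hj : (j : ℕ) < d then a ⟨j, hj⟩ else b) →
      ∑ j, F j = ∑ j, a j + (N - d) * b := by
    obtain ⟨k, rfl⟩ := Nat.exists_eq_add_of_le hdN
    intro F a b hF
    rw [Fin.sum_univ_add]
    simp [hF]
  have hNd : (0 : ℝ) ≤ N - d := sub_nonneg.2 (by exact_mod_cast hdN)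
  have hnn : ∀ (i : Fin N) (j : Fin d), 0 ≤ B (y i) (z j) := fun i j =>
    h.nonneg_of_mem hP1 hP2 (S.subset_Aplus (hy i).1) (S.subset_Aplus (hz.2 j).1)
  -- The first `d` columns hold the overlaps, with row sums `c i`. The other columns meet only
  -- padded zeros and share the deficit `1 - c i` equally; they sum to `1` because `∑ c i = d`.
  let M : Matrix (Fin N) (Fin N) ℝ := Matrix.of fun i j =>
    if hj : (j : ℕ) < d then c i * B (y i) (z ⟨j, hj⟩) else (1 - c i) / (N - d)
  have hM : ∀ i j, M i j =
      if hj : (j : ℕ) < d then c i * B (y i) (z ⟨j, hj⟩) else (1 - c i) / (N - d) :=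
    fun i j => rfl
  -- If `N = d` there are no extra columns, and `∑ c i = N` with `c i ≤ 1` leaves no deficit.
  have hcard : (N : ℝ) - d ≠ 0 ∨ ∀ i, c i = 1 := by
    by_cases hne : (N : ℝ) - d = 0
    · right
      have h1 : ∑ i, (1 - c i) = 0 := by
        rw [Finset.sum_sub_distrib, hcsum]
        simpa using hne
      intro i
      have h2 := (Finset.sum_eq_zero_iff_of_nonneg fun i _ => sub_nonneg.2 (hc i).2).1 h1 i
        (Finset.mem_univ i)
      linarith
    · exact Or.inl hne
  refine ⟨M, mem_doublyStochastic_iff_sum.2 ⟨fun i j => ?_, fun i => ?_, fun j => ?_⟩, ?_⟩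
  · rw [hM]
    split_ifs with hj
    · exact mul_nonneg (hc i).1 (hnn i _)
    · exact div_nonneg (sub_nonneg.2 (hc i).2) hNd
  · rw [hsplit _ (fun j => c i * B (y i) (z j)) _ (hM i), ← Finset.mul_sum,
      Finset.sum_congr rfl fun j _ => h.symm (y i) (z j), ← h.unit_eq_sum hP2 hz,
      S.unit_eq_one (hy i).1]
    rcases hcard with hne | hc1
    · field_simp
      ring
    · simp [hc1]
  · simp only [hM]
    split_ifs with hj
    · have h1 : ∑ i, c i * B (y i) (z ⟨j, hj⟩) = (∑ i, e i) (z ⟨j, hj⟩) := by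
        simp [hey]
      rw [h1, he.1.2, S.unit_eq_one (hz.2 _).1]
    · have hne : (N : ℝ) - d ≠ 0 := by
        have h1 : (d : ℝ) < N := by
          have := j.2
          exact_mod_cast (by omega : d < N)
        exact (sub_pos.2 h1).ne'
      rw [← Finset.sum_div, Finset.sum_sub_distrib, hcsum]
      simp [hne]
  · funext i
    have h1 : (M.mulVec (padZero N p)) i = ∑ j, M i j * padZero N p j := rfl
    rw [h1, sum_padZero (hnd.trans hdN) p (fun j t => M i j * t) (fun j => mul_zero _),
      hvz, hey]
    rw [map_sum, sum_padZero hnd p (fun j t => (c i • B (y i)) (t • z j)) (fun j => by simp)]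
    refine Finset.sum_congr rfl fun j _ => ?_
    have hjd : (j : ℕ) < d := j.2.trans_le hnd
    rw [hM]
    simp only [Fin.val_castLE, hjd, dif_pos, map_smul, LinearMap.smul_apply, smul_eq_mul]
    rw [mul_comm]
    rfl

end IsSpectralForm

end DynamicalStateSpace

/-! ### Schur concavity of the Rényi entropies -/

/-- Jensen's inequality in each row, then unit column sums. -/
theorem ConcaveOn.sum_le_sum_mulVec {N : ℕ} {M : Matrix (Fin N) (Fin N) ℝ}
    (hM : M ∈ doublyStochastic ℝ (Fin N)) {x : Fin N → ℝ} (hx : ∀ i, 0 ≤ x i) {φ : ℝ → ℝ}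
    (hφ : ConcaveOn ℝ (Set.Ici 0) φ) : ∑ i, φ (x i) ≤ ∑ i, φ (M.mulVec x i) := by
  obtain ⟨h0, hrow, hcol⟩ := mem_doublyStochastic_iff_sum.1 hM
  calc ∑ j, φ (x j) = ∑ j, ∑ i, M i j * φ (x j) := by simp [← Finset.sum_mul, hcol]
    _ = ∑ i, ∑ j, M i j * φ (x j) := Finset.sum_comm
    _ ≤ _ := Finset.sum_le_sum fun i _ =>
      hφ.le_map_sum (fun j _ => h0 i j) (hrow i) fun j _ => hx j

/-- This lets the support size, order `0`, be treated as a sum of a concave function. -/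
theorem concaveOn_indicator_pos :
    ConcaveOn ℝ (Set.Ici 0) fun x : ℝ => if 0 < x then (1 : ℝ) else 0 := by
  refine ⟨convex_Ici 0, fun x hx y hy a b ha hb hab => ?_⟩
  have hx : 0 ≤ x := hx
  have hy : 0 ≤ y := hy
  simp only [smul_eq_mul]
  by_cases h : 0 < a * x + b * y
  · rw [if_pos h]
    split_ifs <;> linarith
  · rw [if_neg h]
    have h1 := mul_nonneg ha hx
    have h2 := mul_nonneg hb hy
    have hax : a * x = 0 := by linarith
    have hby : b * y = 0 := by linarith
    rcases mul_eq_zero.1 hax with h3 | h3 <;> rcases mul_eq_zero.1 hby with h4 | h4 <;>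
      simp [h3, h4]

open Classical in
theorem card_pos_eq_sum {n : ℕ} (p : Fin n → ℝ) :
    (Finset.card {j | 0 < p j} : ℝ) = ∑ j, if 0 < p j then (1 : ℝ) else 0 := by
  simp

theorem shannonEntropy_eq_sum {n : ℕ} (p : Fin n → ℝ) :
    shannonEntropy p = (Real.log 2)⁻¹ * ∑ j, Real.negMulLog (p j) := by
  simp only [shannonEntropy, Real.negMulLog, Real.logb, Finset.mul_sum]
  rw [← Finset.sum_neg_distrib]
  refine Finset.sum_congr rfl fun j _ => ?_
  field_simp

theorem sum_rpow_pos {n : ℕ} {p : Fin n → ℝ} (hp0 : ∀ i, 0 ≤ p i) (hp1 : ∑ i, p i = 1) (s : ℝ) :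
    0 < ∑ i, p i ^ s := by
  obtain ⟨i, hi⟩ : ∃ i, p i ≠ 0 := by
    by_contra! hcon
    simp [hcon] at hp1
  exact Finset.sum_pos' (fun j _ => Real.rpow_nonneg (hp0 j) s)
    ⟨i, Finset.mem_univ i, Real.rpow_pos_of_pos (lt_of_le_of_ne (hp0 i) hi.symm) s⟩

theorem iSup_pos_of_sum_eq_one {n : ℕ} {p : Fin n → ℝ} (hp0 : ∀ i, 0 ≤ p i)
    (hp1 : ∑ i, p i = 1) : 0 < ⨆ i, p i := by
  obtain ⟨i, hi⟩ : ∃ i, p i ≠ 0 := by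
    by_contra! hcon
    simp [hcon] at hp1
  exact (lt_of_le_of_ne (hp0 i) hi.symm).trans_le (le_ciSup (Set.finite_range p).bddAbove i)

/-- For finite orders this is concavity of the summand; above order `1` the powers are convex, but
the prefactor `1 / (1 - α)` is negative. At order `∞`, each entry of `M.mulVec x` is an average of
entries of `x`. -/
theorem renyiEntropy_le_mulVec {N : ℕ} {M : Matrix (Fin N) (Fin N) ℝ}
    (hM : M ∈ doublyStochastic ℝ (Fin N)) {x : Fin N → ℝ} (hx0 : ∀ i, 0 ≤ x i)
    (hx1 : ∑ i, x i = 1) (α : ℝ≥0∞) : renyiEntropy α x ≤ renyiEntropy α (M.mulVec x) := by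
  obtain ⟨hM0, hrow, hcol⟩ := mem_doublyStochastic_iff_sum.1 hM
  have hMx : ∀ i, M.mulVec x i = ∑ j, M i j * x j := fun i => rfl
  have hy0 : ∀ i, 0 ≤ M.mulVec x i := fun i => by
    rw [hMx]
    exact Finset.sum_nonneg fun j _ => mul_nonneg (hM0 i j) (hx0 j)
  have hy1 : ∑ i, M.mulVec x i = 1 := by
    simp only [hMx]
    rw [Finset.sum_comm]
    simp only [← Finset.sum_mul, hcol, one_mul, hx1]
  unfold renyiEntropy
  split_ifs with h0 h1 htop
  · rw [card_pos_eq_sum, card_pos_eq_sum]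
    refine Real.logb_le_logb_of_le one_lt_two ?_ (concaveOn_indicator_pos.sum_le_sum_mulVec hM hx0)
    obtain ⟨i, hi⟩ : ∃ i, x i ≠ 0 := by
      by_contra! hcon
      simp [hcon] at hx1
    refine Finset.sum_pos' (fun j _ => by split_ifs <;> simp) ⟨i, Finset.mem_univ i, ?_⟩
    rw [if_pos (lt_of_le_of_ne (hx0 i) hi.symm)]
    exact one_pos
  · rw [shannonEntropy_eq_sum, shannonEntropy_eq_sum]
    exact mul_le_mul_of_nonneg_left (Real.concaveOn_negMulLog.sum_le_sum_mulVec hM hx0)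
      (inv_nonneg.2 (Real.log_nonneg one_le_two))
  · refine neg_le_neg (Real.logb_le_logb_of_le one_lt_two (iSup_pos_of_sum_eq_one hy0 hy1) ?_)
    have hsup := (iSup_pos_of_sum_eq_one hx0 hx1).le
    refine Real.iSup_le (fun i => ?_) hsup
    rw [hMx, ← one_mul (⨆ j, x j), ← hrow i, Finset.sum_mul]
    exact Finset.sum_le_sum fun j _ =>
      mul_le_mul_of_nonneg_left (le_ciSup (Set.finite_range x).bddAbove j) (hM0 i j)
  · have hs0 : 0 < α.toReal := ENNReal.toReal_pos h0 htop
    have hs1 : α.toReal ≠ 1 := fun h => h1 ((ENNReal.toReal_eq_one_iff α).1 h)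
    rcases hs1.lt_or_gt with hs | hs
    · refine mul_le_mul_of_nonneg_left ?_ (one_div_nonneg.2 (sub_nonneg.2 hs.le))
      exact Real.logb_le_logb_of_le one_lt_two (sum_rpow_pos hx0 hx1 _)
        ((Real.concaveOn_rpow hs0.le hs.le).sum_le_sum_mulVec hM hx0)
    · refine mul_le_mul_of_nonpos_left ?_ (one_div_nonpos.2 (sub_nonpos.2 hs.le))
      refine Real.logb_le_logb_of_le one_lt_two (sum_rpow_pos hy0 hy1 _) ?_
      have := (convexOn_rpow hs.le).neg.sum_le_sum_mulVec hM hx0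
      simpa using this

/-- Nonnegativity keeps the added zeros from raising the supremum, and for `n = 0` the real supremum
defaults to `0`. -/
theorem iSup_padZero {n N : ℕ} (h : n ≤ N) {p : Fin n → ℝ} (hp : ∀ i, 0 ≤ p i) :
    ⨆ j, padZero N p j = ⨆ i, p i := by
  have h0 : 0 ≤ ⨆ i, p i := Real.iSup_nonneg hp
  refine le_antisymm (Real.iSup_le (fun j => ?_) h0)
    (Real.iSup_le (fun i => ?_) (Real.iSup_nonneg (padZero_nonneg hp N)))
  · unfold padZero
    split_ifs with hj
    · exact le_ciSup (Set.finite_range p).bddAbove _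
    · exact h0
  · have h1 : p i = padZero N p (Fin.castLE h i) := by simp [padZero]
    rw [h1]
    exact le_ciSup (Set.finite_range (padZero N p)).bddAbove _

theorem renyiEntropy_padZero {n N : ℕ} (h : n ≤ N) {p : Fin n → ℝ} (hp : ∀ i, 0 ≤ p i)
    (α : ℝ≥0∞) : renyiEntropy α (padZero N p) = renyiEntropy α p := by
  unfold renyiEntropy
  split_ifs with h0 h1 htop
  · rw [card_pos_eq_sum, card_pos_eq_sum,
      sum_padZero h p (fun _ t => if 0 < t then (1 : ℝ) else 0) (by simp)]
  · rw [shannonEntropy_eq_sum, shannonEntropy_eq_sum,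
      sum_padZero h p (fun _ t => Real.negMulLog t) (by simp)]
  · rw [iSup_padZero h hp]
  · have hs0 : α.toReal ≠ 0 := (ENNReal.toReal_pos h0 htop).ne'
    rw [sum_padZero h p (fun _ t => t ^ α.toReal) (fun _ => Real.zero_rpow hs0)]

/-! ### Measurement entropy equals spectral entropy -/

namespace DynamicalStateSpace

variable {A : Type*} [NormedAddCommGroup A] [NormedSpace ℝ A] [FiniteDimensional ℝ A]

/-- The Rényi measurement entropies are attained at the spectrum. -/
theorem IsSpectralForm.isLeast_outcomeRenyi {S : DynamicalStateSpace A}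
    {B : LinearMap.BilinForm ℝ A} {d : ℕ} (h : S.IsSpectralForm B d)
    (hP1 : S.ClassicalDecomposability) (hP2 : S.StrongSymmetry) {w : A} {n : ℕ} {p : Fin n → ℝ}
    {v : Fin n → A} (hw : S.IsClassicalDecomposition w p v) (α : ℝ≥0∞) :
    IsLeast (S.outcomeRenyi α w) (renyiEntropy α p) := by
  obtain ⟨hp0, hp1, hv, hwv⟩ := id hw
  have hnd := h.card_le hP2 hv
  constructor
  -- Measuring in a `d`-frame extending `v` reads off exactly the padded spectrum.
  · obtain ⟨z, hz, hvz⟩ := h.exists_extend hP2 hv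
    refine ⟨d, fun k => B (z k), h.isFineGrained hP1 hP2 hz, ?_⟩
    rw [hwv, hvz]
    simp only [h.apply_sum_frame hz]
    exact (renyiEntropy_padZero hnd hp0 α).symm
  · rintro _ ⟨N, e, he, rfl⟩
    have hnN := hnd.trans (h.le_of_isFineGrained hP1 hP2 he)
    obtain ⟨M, hM, hMe⟩ := h.exists_doublyStochastic hP1 hP2 hw he
    rw [hMe, ← renyiEntropy_padZero hnN hp0 α]
    refine renyiEntropy_le_mulVec hM (padZero_nonneg hp0 N) ?_ α
    rw [sum_padZero hnN p (fun _ t => t) (fun _ => rfl), hp1]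

end DynamicalStateSpace

theorem mainTheorem3 {A : Type*} [NormedAddCommGroup A] [NormedSpace ℝ A] [FiniteDimensional ℝ A]
    (S : DynamicalStateSpace A) (hP1 : S.ClassicalDecomposability) (hP2 : S.StrongSymmetry) :
    -- fine-grained effects are multiples of pure states under a self-dualizing inner product
    ((∃ B : LinearMap.BilinForm ℝ A, S.IsSelfDualizing B) ∧
      ∀ B : LinearMap.BilinForm ℝ A, S.IsSelfDualizing B →
        ∀ (N : ℕ) (e : Fin N → Module.Dual ℝ A), S.IsFineGrained e →
          ∀ j, ∃ c ∈ Set.Icc (0 : ℝ) 1, ∃ v, S.IsPure v ∧ e j = c • B v) ∧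
    -- maximal frames are distinguished by fine-grained measurements; `d ≤ N`
    (∃ d : ℕ, S.IsMaxFrameSize d ∧
      (∀ v : Fin d → A, S.IsFrame v →
        ∃ e : Fin d → Module.Dual ℝ A, S.IsFineGrained e ∧
          ∀ k j, e k (v j) = if k = j then 1 else 0) ∧
      ∀ (N : ℕ) (e : Fin N → Module.Dual ℝ A), S.IsFineGrained e → d ≤ N) ∧
    -- outcome probabilities are a bistochastic image of the padded spectrum
    (∀ w ∈ S.Ω, ∀ (n : ℕ) (p : Fin n → ℝ) (v : Fin n → A), S.IsClassicalDecomposition w p v →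
      ∀ (N : ℕ) (e : Fin N → Module.Dual ℝ A), S.IsFineGrained e →
        ∃ M ∈ doublyStochastic ℝ (Fin N), (fun j => e j w) = M.mulVec (padZero N p)) ∧
    -- the measurement entropies are the spectral entropies
    (∀ w ∈ S.Ω, ∀ (n : ℕ) (p : Fin n → ℝ) (v : Fin n → A), S.IsClassicalDecomposition w p v →
      (∀ α : ℝ≥0∞, IsGLB (S.outcomeRenyi α w) (renyiEntropy α p) ∧
        S.renyiMeasurementEntropy α w = renyiEntropy α p) ∧
      S.measurementEntropy w = -∑ j, p j * Real.logb 2 (p j)) := by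
  obtain ⟨B, d, h⟩ := S.exists_isSpectralForm hP1 hP2
  refine ⟨⟨⟨B, h.isSelfDualizing hP1 hP2⟩, fun B' hB' N e he j =>
    h.exists_eq_smul hP1 hP2 hB' he j⟩, ⟨d, h.isMaxFrameSize hP2, fun v hv =>
    ⟨fun k => B (v k), h.isFineGrained hP1 hP2 hv, h.apply_frame hv⟩, fun N e he =>
    h.le_of_isFineGrained hP1 hP2 he⟩, fun w _ n p v hw N e he =>
    h.exists_doublyStochastic hP1 hP2 hw he, fun w _ n p v hw => ⟨fun α => ?_, ?_⟩⟩
  · have hl := h.isLeast_outcomeRenyi hP1 hP2 hw α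
    exact ⟨hl.isGLB, hl.csInf_eq⟩
  · have h1 := (h.isLeast_outcomeRenyi hP1 hP2 hw 1).csInf_eq
    have h2 : ∀ {m : ℕ} (q : Fin m → ℝ), renyiEntropy 1 q = shannonEntropy q := by
      intro m q
      simp [renyiEntropy]
    simp only [DynamicalStateSpace.outcomeRenyi, h2] at h1
    exact h1
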